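/- Let $R$ be a Noetherian integral domain of prime characteristic $p>0$ and finite Krull dimension, and let $S$ be a commutative ring containing $R$ as a subring which is finitely generated as an $R$-module and has rank $r$ as an $R$-module. For a commutative $R$-algebra $B$ of characteristic $p$ and finite Krull dimension $d$, let $F_B$ be the Frobenius functor (base change along $b\mapsto b^p$) and, for a bounded complex $C_\bullet$ of free $B$-modules such that all $F_B^n(C_\bullet)$, $n\ge 0$, have homology of finite length over $R$, put $$\chi(C_\bullet)=\sum_i(-1)^i\,\ell_R(H_i(C_\bullet)),\qquad \chi_\infty(C_\bullet)=\lim_{n\to\infty}\frac{\chi(F_B^n(C_\bullet))}{p^{nd}} .$$ Let $G_\bullet$ be a complex $0\to G_s\to\cdots\to G_0\to 0$ of free $R$-modules with homology of finite length. Then all $F_R^n(G_\bullet)$ and all $F_S^n(G_\bullet\otimes_R S)$ have homology of finite length over $R$, the limits $\chi_\infty(G_\bullet)$ and $\chi_\infty(G_\bullet\otimes_R S)$ exist, and $$\chi_\infty(G_\bullet\otimes_R S)=r\cdot\chi_\infty(G_\bullet).$$ If moreover $R\to S/\mathfrak n$ is surjective for every maximal ideal $\mathfrak n$ of $S$ (no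 residue field extension), then the same holds when the lengths defining $\chi_\infty(G_\bullet\otimes_R S)$ are taken over $S$. -/

import Mathlib

open CategoryTheory

universe u

noncomputable section

/-- Extension of scalars along a ring homomorphism is additive (it is a left adjoint). -/
instance extendScalars_additive {A B : Type u} [CommRing A] [CommRing B] (f : A →+* B) :
    (ModuleCat.extendScalars.{u, u, u} f).Additive :=
  (ModuleCat.extendRestrictScalarsAdj.{u, u, u} f).left_adjoint_additive

/-- The base change `C ⊗_A B` of a chain complex of `A`-modules along a ring homomorphism
`f : A → B`, as a chain complex of `B`-modules. -/
def baseChange {A B : Type u} [CommRing A] [CommRing B] (f : A →+* B)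
    (C : ChainComplex (ModuleCat.{u} A) ℕ) : ChainComplex (ModuleCat.{u} B) ℕ :=
  ((ModuleCat.extendScalars.{u, u, u} f).mapHomologicalComplex (ComplexShape.down ℕ)).obj C

/-- The Frobenius functor on complexes over a commutative ring of prime characteristic `p`:
base change along the Frobenius endomorphism `b ↦ b ^ p`. -/
def frobeniusFunctor (p : ℕ) (B : Type u) [CommRing B] [Fact p.Prime] [CharP B p]
    (C : ChainComplex (ModuleCat.{u} B) ℕ) : ChainComplex (ModuleCat.{u} B) ℕ :=
  baseChange (frobenius B p) C

/-- A complex `⋯ → C₁ → C₀ → 0` is bounded if its terms vanish in all large degrees. -/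
def IsBoundedComplex {B : Type u} [CommRing B] (C : ChainComplex (ModuleCat.{u} B) ℕ) : Prop :=
  ∃ s : ℕ, ∀ i, s < i → Subsingleton (C.X i)

/-- All terms of the complex are free modules. -/
def IsFreeComplex {B : Type u} [CommRing B] (C : ChainComplex (ModuleCat.{u} B) ℕ) : Prop :=
  ∀ i, Module.Free B (C.X i)

/-- The `i`-th homology module of a complex of `B`-modules, as a module over a ring `A` of which
`B` is an algebra. -/
def homologyOver (A : Type u) {B : Type u} [CommRing A] [CommRing B] [Algebra A B]
    (C : ChainComplex (ModuleCat.{u} B) ℕ) (i : ℕ) : ModuleCat.{u} A :=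
  (ModuleCat.restrictScalars (algebraMap A B)).obj (C.homology i)

/-- The complex of `B`-modules `C` has homology of finite length over `A`. -/
def HasFiniteLengthHomology (A : Type u) {B : Type u} [CommRing A] [CommRing B] [Algebra A B]
    (C : ChainComplex (ModuleCat.{u} B) ℕ) : Prop :=
  ∀ i, IsFiniteLength A (homologyOver A C i)

/-- The Euler characteristic `χ(C) = ∑ᵢ (-1)ⁱ ℓ_A(Hᵢ(C))`, with lengths taken over `A`. (It is
meaningful for bounded complexes with finite length homology; the sum is then a finite sum of
finite lengths.) -/
def eulerChar (A : Type u) {B : Type u} [CommRing A] [CommRing B] [Algebra A B]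
    (C : ChainComplex (ModuleCat.{u} B) ℕ) : ℤ :=
  ∑ᶠ i : ℕ, (-1) ^ i * ((Module.length A (homologyOver A C i)).toNat : ℤ)

/-- The Krull dimension of a nonzero ring of finite Krull dimension, as a natural number. -/
def krullDimNat (B : Type u) [CommRing B] : ℕ :=
  ((ringKrullDim B).unbotD 0).toNat

/-- `IsLimitMultiplicity p A C L` says that the limit multiplicity
`χ_∞(C) = lim_{n → ∞} χ(Fⁿ(C)) / p ^ (n * dim B)` of the complex of `B`-modules `C`, with lengths
taken over `A`, is defined (all `Fⁿ(C)` have finite length homology and the limit exists) and is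
equal to `L`. -/
def IsLimitMultiplicity (p : ℕ) (A : Type u) {B : Type u} [CommRing A] [CommRing B] [Algebra A B]
    [Fact p.Prime] [CharP B p] (C : ChainComplex (ModuleCat.{u} B) ℕ) (L : ℝ) : Prop :=
  (∀ n : ℕ, HasFiniteLengthHomology A ((frobeniusFunctor p B)^[n] C)) ∧
    Filter.Tendsto
      (fun n : ℕ => (eulerChar A ((frobeniusFunctor p B)^[n] C) : ℝ) /
        (p : ℝ) ^ (n * krullDimNat B))
      Filter.atTop (nhds L)

end

-- Write d for the dimension of R and q for pⁿ. For an R-module M put χₙ(M) = χ(M ⊗ Fⁿ(G)), where Fⁿ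
-- is the iterated Frobenius functor of R. As a complex of R-modules, the n-th Frobenius pull-back
-- of the base change of G to S is S ⊗ Fⁿ(G), so the number to be compared with χₙ(R) is χₙ(S).
-- There is an injection of a free module of rank r into S with torsion cokernel; χₙ is additive on
-- short exact sequences, so it suffices that χₙ of a torsion module is O(q^(d-1)).
--
-- This growth estimate rests on homotopies. If x kills the homology of G, some power of x is
-- null-homotopic on G, and homotopies survive every base change; if x itself is null-homotopic,
-- then x^q kills the homology of M ⊗ Fⁿ(G) for all M. For a prime P not containing x, the homology
-- of R/P therefore embeds in that of R/(P + x^q), which is filtered by q copies of R/(P + x). Each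
-- drop in dimension costs one factor q, until a maximal ideal is reached, where the homology is
-- independent of n. A prime filtration handles general modules (`exists_homologyLength_le`,
-- `exists_abs_tensorChi_sub_le`).
--
-- Existence of the limit uses the same estimate. Each of the finitely many maximal ideals that
-- matter has a flat local extension T of R whose maximal ideal is generated by the given one and
-- which is complete, Noetherian, F-finite, and has a perfect residue field
-- (`exists_flat_local_extension`). For a domain D = T/P, let N be D regarded as a module through
-- Frobenius. Lengths do not change under this restriction, so χₙ₊₁(D) = χₙ(N) = rank(N) χₙ(D) +
-- O(q^(d-1)). Hence χₙ(D)/q^d is a bounded sequence satisfying a linear recursion up to a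
-- geometrically small error, and it converges (`exists_tendsto_of_abs_sub_le`). A prime filtration
-- of T and a sum over the maximal ideals give the limit over R.

universe v

open scoped TensorProduct

noncomputable section

/-! ### Tensor functors along a ring homomorphism -/

namespace ModuleCat

variable {A B : Type u} [CommRing A] [CommRing B] (φ : A →+* B)

instance restrictScalars_smulCommClass (M : ModuleCat.{u} B) :
    SMulCommClass A B ((restrictScalars φ).obj M) where
  smul_comm a b m := smul_comm (φ a) b (show M from m)

/-- For a ring homomorphism `φ : A → B` and a `B`-module `M`, the functor `N ↦ M ⊗_A N` from
`A`-modules to `B`-modules. -/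
def tensorAlong (M : ModuleCat.{u} B) : ModuleCat.{u} A ⥤ ModuleCat.{u} B where
  obj N := of B (TensorProduct A ((restrictScalars φ).obj M) N)
  map {N N'} l := ofHom
    { toFun := LinearMap.lTensor ((restrictScalars φ).obj M) l.hom
      map_add' := map_add _
      map_smul' := fun b x => by
        induction x using TensorProduct.induction_on with
        | zero => simp
        | tmul => rfl
        | add _ _ h1 h2 => simp only [smul_add, map_add, h1, h2] }
  map_id N := by
    ext x
    exact congrArg (fun f => f x) (LinearMap.lTensor_id ((restrictScalars φ).obj M) N)
  map_comp {N N' N''} f g := by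
    ext x
    exact congrArg (fun f => f x) (LinearMap.lTensor_comp ((restrictScalars φ).obj M) g.hom f.hom)

instance tensorAlong_additive (M : ModuleCat.{u} B) : (tensorAlong φ M).Additive where
  map_add {N N' f g} := by
    ext x
    exact congrArg (fun f => f x)
      (LinearMap.lTensor_add ((restrictScalars φ).obj M) f.hom g.hom)

theorem tensorAlong_map_smul (M : ModuleCat.{u} B) {N N' : ModuleCat.{u} A} (a : A)
    (f : N ⟶ N') : (tensorAlong φ M).map (a • f) = φ a • (tensorAlong φ M).map f := by
  ext x
  exact congrArg (fun f => f x)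
    (LinearMap.lTensor_smul ((restrictScalars φ).obj M) a f.hom)

/-- The natural transformation `M ⊗_A - ⟶ M' ⊗_A -` induced by a `B`-linear map `M → M'`. -/
def tensorAlongMap {M M' : ModuleCat.{u} B} (g : M ⟶ M') :
    tensorAlong φ M ⟶ tensorAlong φ M' where
  app N := ofHom
    { toFun := LinearMap.rTensor N ((restrictScalars φ).map g).hom
      map_add' := map_add _
      map_smul' := fun b x => by
        induction x using TensorProduct.induction_on with
        | zero => simp
        | tmul m n =>
          refine (congrArg (fun y : M' => TensorProduct.tmul A (M := (restrictScalars φ).obj M')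
            y n) (g.hom.map_smul b m))
        | add _ _ h1 h2 => simp only [smul_add, map_add, h1, h2] }
  naturality {N N'} f := by
    ext x
    exact congrArg (fun h => h x) ((LinearMap.rTensor_comp_lTensor _
      ((restrictScalars φ).map g).hom f.hom).trans (LinearMap.lTensor_comp_rTensor _ _ _).symm)

theorem tensorAlongMap_smul_id (M : ModuleCat.{u} B) (b : B) (N : ModuleCat.{u} A) :
    (tensorAlongMap φ (b • 𝟙 M)).app N = b • 𝟙 ((tensorAlong φ M).obj N) := by
  ext x
  induction x using TensorProduct.induction_on with
  | zero => exact (map_zero _).trans (map_zero _).symm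
  | tmul => rfl
  | add _ _ h1 h2 => exact (map_add _ _ _).trans ((congrArg₂ (· + ·) h1 h2).trans (map_add _ _ _).symm)

theorem tensorAlongMap_comp {M M' M'' : ModuleCat.{u} B} (f : M ⟶ M') (g : M' ⟶ M'') :
    tensorAlongMap φ (f ≫ g) = tensorAlongMap φ f ≫ tensorAlongMap φ g := by
  ext N x
  exact congrArg (fun f => f x) (LinearMap.rTensor_comp N ((restrictScalars φ).map g).hom
    ((restrictScalars φ).map f).hom)

theorem tensorAlongMap_id (M : ModuleCat.{u} B) :
    tensorAlongMap φ (𝟙 M) = 𝟙 _ := by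
  ext N x
  exact congrArg (fun f => f x) (LinearMap.rTensor_id N ((restrictScalars φ).obj M))

/-- Isomorphic coefficient modules give isomorphic tensor functors. -/
def tensorAlongIso {M M' : ModuleCat.{u} B} (e : M ≅ M') :
    tensorAlong φ M ≅ tensorAlong φ M' where
  hom := tensorAlongMap φ e.hom
  inv := tensorAlongMap φ e.inv
  hom_inv_id := by rw [← tensorAlongMap_comp, e.hom_inv_id, tensorAlongMap_id]
  inv_hom_id := by rw [← tensorAlongMap_comp, e.inv_hom_id, tensorAlongMap_id]

/-- The short complex `M₁ ⊗ N → M₂ ⊗ N → M₃ ⊗ N` is short exact when `0 → M₁ → M₂ → M₃ → 0` is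
and `N` is flat. -/
theorem tensorAlong_shortExact {S : ShortComplex (ModuleCat.{u} B)} (hS : S.ShortExact)
    (N : ModuleCat.{u} A) [Module.Flat A N] (h0 : (tensorAlongMap φ S.f).app N ≫
      (tensorAlongMap φ S.g).app N = 0) :
    (ShortComplex.mk _ _ h0).ShortExact := by
  have hinj : Function.Injective S.f := (ModuleCat.mono_iff_injective _).1 hS.mono_f
  have hsurj : Function.Surjective S.g := (ModuleCat.epi_iff_surjective _).1 hS.epi_g
  have hex := (ShortComplex.ShortExact.moduleCat_exact_iff_function_exact S).1 hS.exact
  refine ShortComplex.ShortExact.mk' ?_ ?_ ?_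
  · rw [ShortComplex.ShortExact.moduleCat_exact_iff_function_exact]
    exact rTensor_exact N (f := ((restrictScalars φ).map S.f).hom)
      (g := ((restrictScalars φ).map S.g).hom) hex hsurj
  · rw [ModuleCat.mono_iff_injective]
    exact Module.Flat.rTensor_preserves_injective_linearMap ((restrictScalars φ).map S.f).hom hinj
  · rw [ModuleCat.epi_iff_surjective]
    exact LinearMap.rTensor_surjective N (g := ((restrictScalars φ).map S.g).hom) hsurj

end ModuleCat

/-! ### Lengths and Euler characteristics in long exact sequences -/

section LengthLemmas

variable {B : Type u} [CommRing B]

theorem length_eq_ker_add_range {M N : Type*} [AddCommGroup M] [AddCommGroup N] [Module B M]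
    [Module B N] (g : M →ₗ[B] N) :
    Module.length B M = Module.length B (LinearMap.ker g) + Module.length B (LinearMap.range g) :=
  Module.length_eq_add_of_exact (LinearMap.ker g).subtype g.rangeRestrict
    (Submodule.injective_subtype _) g.surjective_rangeRestrict (by
      rw [LinearMap.exact_iff, LinearMap.ker_rangeRestrict, Submodule.range_subtype])

theorem length_le_add_of_exact {M₁ M₂ M₃ : Type*} [AddCommGroup M₁] [AddCommGroup M₂]
    [AddCommGroup M₃] [Module B M₁] [Module B M₂] [Module B M₃] (f : M₁ →ₗ[B] M₂) (g : M₂ →ₗ[B] M₃)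
    (h : Function.Exact f g) :
    Module.length B M₂ ≤ Module.length B M₁ + Module.length B M₃ := by
  rw [length_eq_ker_add_range g]
  refine add_le_add ?_ (Module.length_le_of_injective (LinearMap.range g).subtype
    (Submodule.injective_subtype _))
  rw [(LinearMap.exact_iff.1 h)]
  exact Module.length_le_of_surjective f.rangeRestrict f.surjective_rangeRestrict

end LengthLemmas

section LongExact

variable {B : Type u} [CommRing B] {S : ShortComplex (ChainComplex (ModuleCat.{u} B) ℕ)}
  (hS : S.ShortExact)
include hS

theorem exact_homologyMap (i : ℕ) :
    Function.Exact (HomologicalComplex.homologyMap S.f i).hom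
      (HomologicalComplex.homologyMap S.g i).hom :=
  (ShortComplex.ShortExact.moduleCat_exact_iff_function_exact _).1 (hS.homology_exact₂ i)

theorem exact_delta_left (i : ℕ) :
    Function.Exact (hS.δ (i + 1) i rfl).hom (HomologicalComplex.homologyMap S.f i).hom :=
  (ShortComplex.ShortExact.moduleCat_exact_iff_function_exact _).1 (hS.homology_exact₁ (i + 1) i rfl)

theorem exact_delta_right (i : ℕ) :
    Function.Exact (HomologicalComplex.homologyMap S.g (i + 1)).hom (hS.δ (i + 1) i rfl).hom :=
  (ShortComplex.ShortExact.moduleCat_exact_iff_function_exact _).1 (hS.homology_exact₃ (i + 1) i rfl)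

theorem surjective_homologyMap_zero :
    Function.Surjective (HomologicalComplex.homologyMap S.g 0).hom := by
  have := hS.epi_g
  have : Epi (HomologicalComplex.homologyMap S.g 0) :=
    HomologicalComplex.epi_homologyMap_of_epi_of_not_rel _ _ (by simp)
  exact (ModuleCat.epi_iff_surjective _).1 this

theorem length_homology_le (i : ℕ) :
    Module.length B (S.X₂.homology i) ≤
      Module.length B (S.X₁.homology i) + Module.length B (S.X₃.homology i) :=
  length_le_add_of_exact _ _ (exact_homologyMap hS i)

theorem length_homology_le_of_map_eq_zero (i : ℕ) (h0 : HomologicalComplex.homologyMap S.f i = 0) :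
    Module.length B (S.X₂.homology i) ≤ Module.length B (S.X₃.homology i) := by
  refine Module.length_le_of_injective (HomologicalComplex.homologyMap S.g i).hom ?_
  have := exact_homologyMap hS i
  rw [h0] at this
  rw [← LinearMap.ker_eq_bot, LinearMap.exact_iff.1 this, ModuleCat.hom_zero, LinearMap.range_zero]

omit hS in
theorem eulerChar_eq_sum (C : ChainComplex (ModuleCat.{u} B) ℕ) (s : ℕ)
    (h : ∀ i, s ≤ i → Module.length B (C.homology i) = 0) :
    eulerChar B C = ∑ i ∈ Finset.range s, (-1) ^ i * ((Module.length B (C.homology i)).toNat : ℤ) := by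
  unfold eulerChar
  refine finsum_eq_sum_of_support_subset _ fun i hi => ?_
  by_contra hc
  simp only [Finset.coe_range, Set.mem_Iio, not_lt] at hc
  refine hi ?_
  have := h i hc
  change (-1) ^ i * ((Module.length B (C.homology i)).toNat : ℤ) = 0
  rw [this]; simp

/-- Every length in the long exact sequence is a sum of the lengths of two consecutive images; in
the alternating sum the images of the connecting maps cancel. -/
theorem eulerChar_add_of_shortExact (s : ℕ)
    (f1 : ∀ i, Module.length B (S.X₁.homology i) ≠ ⊤)
    (f3 : ∀ i, Module.length B (S.X₃.homology i) ≠ ⊤)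
    (h1 : ∀ i, s ≤ i → Module.length B (S.X₁.homology i) = 0)
    (h3 : ∀ i, s ≤ i → Module.length B (S.X₃.homology i) = 0) :
    eulerChar B S.X₂ = eulerChar B S.X₁ + eulerChar B S.X₃ := by
  have h2 : ∀ i, s ≤ i → Module.length B (S.X₂.homology i) = 0 := fun i hi => by
    have := length_homology_le hS i
    rw [h1 i hi, h3 i hi] at this
    simpa using this
  rw [eulerChar_eq_sum _ s h1, eulerChar_eq_sum _ s h2, eulerChar_eq_sum _ s h3]
  let b : ℕ → ℕ∞ := fun i => Module.length B (LinearMap.range (hS.δ (i + 1) i rfl).hom)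
  have hb : ∀ i, b i ≠ ⊤ := fun i => ne_top_of_le_ne_top (f1 i)
    (Module.length_le_of_injective _ (Submodule.injective_subtype _))
  have hbs : ∀ i, s ≤ i → b i = 0 := fun i hi => le_antisymm ((h1 i hi) ▸
    (Module.length_le_of_injective _ (Submodule.injective_subtype _))) zero_le
  have hf : ∀ i, Module.length B (S.X₁.homology i) = b i +
      Module.length B (LinearMap.range (HomologicalComplex.homologyMap S.f i).hom) := fun i => by
    rw [length_eq_ker_add_range (HomologicalComplex.homologyMap S.f i).hom,
      LinearMap.exact_iff.1 (exact_delta_left hS i)]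
  have hm : ∀ i, Module.length B (S.X₂.homology i) =
      Module.length B (LinearMap.range (HomologicalComplex.homologyMap S.f i).hom) +
      Module.length B (LinearMap.range (HomologicalComplex.homologyMap S.g i).hom) := fun i => by
    rw [length_eq_ker_add_range (HomologicalComplex.homologyMap S.g i).hom,
      LinearMap.exact_iff.1 (exact_homologyMap hS i)]
  have hg0 : Module.length B (S.X₃.homology 0) =
      Module.length B (LinearMap.range (HomologicalComplex.homologyMap S.g 0).hom) := by
    rw [LinearMap.range_eq_top.2 (surjective_homologyMap_zero hS), Module.length_top]
  have hg : ∀ i, Module.length B (S.X₃.homology (i + 1)) =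
      Module.length B (LinearMap.range (HomologicalComplex.homologyMap S.g (i + 1)).hom) + b i :=
    fun i => by
    rw [length_eq_ker_add_range (hS.δ (i + 1) i rfl).hom,
      LinearMap.exact_iff.1 (exact_delta_right hS i)]
  -- Truncating at degree n leaves one uncancelled term, the image `b n` of the connecting map into
  -- degree n of the first complex. It vanishes at n = s.
  have key : ∀ n : ℕ,
      ∑ i ∈ Finset.range (n + 1), (-1) ^ i * ((Module.length B (S.X₂.homology i)).toNat : ℤ) +
        (-1) ^ n * ((b n).toNat : ℤ) =
      ∑ i ∈ Finset.range (n + 1), (-1) ^ i * ((Module.length B (S.X₁.homology i)).toNat : ℤ) +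
      ∑ i ∈ Finset.range (n + 1), (-1) ^ i * ((Module.length B (S.X₃.homology i)).toNat : ℤ) := by
    have fin : ∀ i, ∃ b' f' g' : ℕ, b i = b' ∧
        Module.length B (LinearMap.range (HomologicalComplex.homologyMap S.f i).hom) = f' ∧
        Module.length B (LinearMap.range (HomologicalComplex.homologyMap S.g i).hom) = g' := by
      intro i
      refine ⟨_, _, _, (ENat.natCast_toNat (hb i)).symm, (ENat.natCast_toNat (ne_top_of_le_ne_top (f1 i)
        ((hf i).symm ▸ le_add_self))).symm, (ENat.natCast_toNat (ne_top_of_le_ne_top (f3 i)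
        (Module.length_le_of_injective _ (Submodule.injective_subtype _)))).symm⟩
    intro n
    induction n with
    | zero =>
      obtain ⟨b', f', g', e1, e2, e3⟩ := fin 0
      simp only [zero_add, Finset.sum_range_one, pow_zero, one_mul]
      rw [hf 0, hm 0, hg0, e1, e2, e3]
      norm_cast
      simp only [ENat.toNat_natCast]
      ring
    | succ n ih =>
      obtain ⟨b', f', g', e1, e2, e3⟩ := fin (n + 1)
      obtain ⟨b0, _, _, e0, _, _⟩ := fin n
      rw [Finset.sum_range_succ _ (n + 1), Finset.sum_range_succ _ (n + 1),
        Finset.sum_range_succ _ (n + 1), hf (n + 1), hm (n + 1), hg n, e1, e2, e3]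
      rw [e0] at ih ⊢
      norm_cast at ih ⊢
      simp only [ENat.toNat_natCast] at ih ⊢
      push_cast at ih ⊢
      rw [pow_succ]
      linear_combination ih
  have ks := key s
  rw [Finset.sum_range_succ, Finset.sum_range_succ, Finset.sum_range_succ, h1 s le_rfl,
    h2 s le_rfl, h3 s le_rfl, hbs s le_rfl] at ks
  simpa using ks

end LongExact

/-! ### Complexes of the form M ⊗ G -/

section TensorComplex

variable {A B : Type u} [CommRing A] [CommRing B] (φ : A →+* B)

/-- The complex `M ⊗_A G` of `B`-modules, for a ring homomorphism `φ : A → B`, a `B`-module `M`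
and a complex `G` of `A`-modules. -/
def tensorComplex (M : ModuleCat.{u} B) (G : ChainComplex (ModuleCat.{u} A) ℕ) :
    ChainComplex (ModuleCat.{u} B) ℕ :=
  ((ModuleCat.tensorAlong φ M).mapHomologicalComplex (ComplexShape.down ℕ)).obj G

/-- The map `M ⊗_A G ⟶ M' ⊗_A G` of complexes induced by `M ⟶ M'`. -/
def tensorComplexMap {M M' : ModuleCat.{u} B} (f : M ⟶ M')
    (G : ChainComplex (ModuleCat.{u} A) ℕ) : tensorComplex φ M G ⟶ tensorComplex φ M' G :=
  (NatTrans.mapHomologicalComplex (ModuleCat.tensorAlongMap φ f) (ComplexShape.down ℕ)).app G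

/-- Isomorphic coefficient modules give isomorphic complexes. -/
def tensorComplexIso {M M' : ModuleCat.{u} B} (e : M ≅ M')
    (G : ChainComplex (ModuleCat.{u} A) ℕ) : tensorComplex φ M G ≅ tensorComplex φ M' G :=
  (NatIso.mapHomologicalComplex (ModuleCat.tensorAlongIso φ e) (ComplexShape.down ℕ)).app G

theorem tensorComplexMap_comp_eq_zero {M₁ M₂ M₃ : ModuleCat.{u} B} (f : M₁ ⟶ M₂) (g : M₂ ⟶ M₃)
    (h : f ≫ g = 0) (G : ChainComplex (ModuleCat.{u} A) ℕ) :
    tensorComplexMap φ f G ≫ tensorComplexMap φ g G = 0 := by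
  ext i : 1
  have h1 : (ModuleCat.tensorAlongMap φ (f ≫ g)).app (G.X i) = 0 := by
    rw [h]
    ext x
    exact congrArg (fun f => f x) (LinearMap.rTensor_zero (R := A) (G.X i)
      (N := (ModuleCat.restrictScalars φ).obj M₁) (P := (ModuleCat.restrictScalars φ).obj M₃))
  rw [ModuleCat.tensorAlongMap_comp] at h1
  exact h1

/-- The short complex of complexes `M₁ ⊗ G → M₂ ⊗ G → M₃ ⊗ G`. -/
def tensorShortComplex (S : ShortComplex (ModuleCat.{u} B)) (G : ChainComplex (ModuleCat.{u} A) ℕ) :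
    ShortComplex (ChainComplex (ModuleCat.{u} B) ℕ) :=
  ShortComplex.mk (tensorComplexMap φ S.f G) (tensorComplexMap φ S.g G)
    (tensorComplexMap_comp_eq_zero φ _ _ S.zero G)

theorem tensorShortComplex_shortExact {S : ShortComplex (ModuleCat.{u} B)} (hS : S.ShortExact)
    (G : ChainComplex (ModuleCat.{u} A) ℕ) (hG : ∀ i, Module.Flat A (G.X i)) :
    (tensorShortComplex φ S G).ShortExact := by
  refine HomologicalComplex.shortExact_of_degreewise_shortExact _ fun i => ?_
  have := hG i
  exact ModuleCat.tensorAlong_shortExact φ hS (G.X i) _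

/-- The length of the `i`-th homology module of `M ⊗_A G`. -/
def homologyLength (M : ModuleCat.{u} B) (G : ChainComplex (ModuleCat.{u} A) ℕ) (i : ℕ) : ℕ∞ :=
  Module.length B ((tensorComplex φ M G).homology i)

variable (G : ChainComplex (ModuleCat.{u} A) ℕ)

theorem length_homology_eq_of_iso {C D : ChainComplex (ModuleCat.{u} B) ℕ} (e : C ≅ D) (i : ℕ) :
    Module.length B (C.homology i) = Module.length B (D.homology i) :=
  (HomologicalComplex.homologyMapIso e i).toLinearEquiv.length_eq

theorem eulerChar_eq_of_iso {C D : ChainComplex (ModuleCat.{u} B) ℕ} (e : C ≅ D) :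
    eulerChar B C = eulerChar B D := by
  refine finsum_congr fun i => ?_
  have := length_homology_eq_of_iso e i
  change (-1) ^ i * ((Module.length B (C.homology i)).toNat : ℤ) =
    (-1) ^ i * ((Module.length B (D.homology i)).toNat : ℤ)
  rw [this]

theorem homologyLength_congr {M M' : ModuleCat.{u} B} (e : M ≅ M') (i : ℕ) :
    homologyLength φ M G i = homologyLength φ M' G i :=
  length_homology_eq_of_iso (tensorComplexIso φ e G) i

theorem homologyLength_eq_zero_of_subsingleton (M : ModuleCat.{u} B) (i : ℕ)
    [Subsingleton (G.X i)] : homologyLength φ M G i = 0 := by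
  have h1 : Subsingleton ((tensorComplex φ M G).X i) :=
    inferInstanceAs (Subsingleton (TensorProduct A ((ModuleCat.restrictScalars φ).obj M) (G.X i)))
  have h2 : Limits.IsZero ((tensorComplex φ M G).X i) := ModuleCat.isZero_of_subsingleton _
  have h3 := (HomologicalComplex.ExactAt.of_isZero (K := tensorComplex φ M G) h2).isZero_homology
  have : Subsingleton ((tensorComplex φ M G).homology i) := ModuleCat.subsingleton_of_isZero h3
  exact Module.length_eq_zero

theorem homologyLength_eq_zero_of_subsingleton_coeff (M : ModuleCat.{u} B) (i : ℕ)
    [Subsingleton M] : homologyLength φ M G i = 0 := by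
  have h0 : Subsingleton ((ModuleCat.restrictScalars φ).obj M) := inferInstanceAs (Subsingleton M)
  have h1 : Subsingleton ((tensorComplex φ M G).X i) :=
    inferInstanceAs (Subsingleton (TensorProduct A ((ModuleCat.restrictScalars φ).obj M) (G.X i)))
  have h2 : Limits.IsZero ((tensorComplex φ M G).X i) := ModuleCat.isZero_of_subsingleton _
  have h3 := (HomologicalComplex.ExactAt.of_isZero (K := tensorComplex φ M G) h2).isZero_homology
  have : Subsingleton ((tensorComplex φ M G).homology i) := ModuleCat.subsingleton_of_isZero h3
  exact Module.length_eq_zero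

theorem homologyMap_tensorComplexMap_smul (M : ModuleCat.{u} B) (b : B) (i : ℕ) :
    HomologicalComplex.homologyMap (tensorComplexMap φ (b • 𝟙 M) G) i = b • 𝟙 _ := by
  have h : tensorComplexMap φ (b • 𝟙 M) G = b • 𝟙 _ := by
    ext j : 1
    exact ModuleCat.tensorAlongMap_smul_id φ M b (G.X j)
  rw [h]
  refine Eq.trans (ShortComplex.homologyMap_smul ((HomologicalComplex.shortComplexFunctor
    (ModuleCat.{u} B) (ComplexShape.down ℕ) i).map (𝟙 (tensorComplex φ M G))) b) ?_
  exact congrArg (b • ·) (HomologicalComplex.homologyMap_id (tensorComplex φ M G) i)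

end TensorComplex

/-! ### From annihilators of homology to null-homotopies -/

section NullHomotopy

variable {A : Type u} [CommRing A]

/-- Multiplication by x turns cycles into boundaries, and projectivity of P lifts the resulting map
through the differential. -/
theorem exists_lift_of_smul_homology_eq_zero (K : ChainComplex (ModuleCat.{u} A) ℕ) (x : A) (i : ℕ)
    (hx : x • 𝟙 (K.homology i) = 0) {P : ModuleCat.{u} A} [Projective P] (f : P ⟶ K.X i)
    (hf : f ≫ K.d i ((ComplexShape.down ℕ).next i) = 0) :
    ∃ h : P ⟶ K.X (i + 1), h ≫ K.d (i + 1) i = x • f := by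
  have hex : (ShortComplex.mk (K.toCycles (i + 1) i) (K.homologyπ i) (by simp)).Exact :=
    ShortComplex.exact_of_g_is_cokernel _ (K.homologyIsCokernel (i + 1) i (by simp))
  have h0 : (x • K.liftCycles f _ rfl hf) ≫ K.homologyπ i = 0 := by
    have : (x • K.liftCycles f _ rfl hf) ≫ K.homologyπ i =
        (K.liftCycles f _ rfl hf ≫ K.homologyπ i) ≫ (x • 𝟙 (K.homology i)) := by simp
    rw [this, hx, Limits.comp_zero]
  refine ⟨hex.liftFromProjective _ h0, ?_⟩
  have h1 := hex.liftFromProjective_comp _ h0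
  dsimp only at h1
  rw [← K.toCycles_i (i + 1) i, ← Category.assoc, h1]
  simp

/-- The homotopy is built degree by degree, each new degree costing one more factor x. In degree 0
the `next` of 0 is 0 itself, so the conditional removes the term that has no meaning there. -/
theorem exists_contraction_up_to (G : ChainComplex (ModuleCat.{u} A) ℕ)
    (hproj : ∀ i, Projective (G.X i)) (x : A) (hx : ∀ i, x • 𝟙 (G.homology i) = 0) (k : ℕ) :
    ∃ (m : ℕ) (h : ∀ i, G.X i ⟶ G.X (i + 1)), ∀ i, i < k →
      G.d i ((ComplexShape.down ℕ).next i) ≫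
        (if hi : (ComplexShape.down ℕ).next i + 1 = i then
          h ((ComplexShape.down ℕ).next i) ≫ eqToHom (by rw [hi]) else 0) +
        h i ≫ G.d (i + 1) i = x ^ m • 𝟙 (G.X i) := by
  induction k with
  | zero => exact ⟨0, fun i => 0, by simp⟩
  | succ k ih =>
    obtain ⟨m, h, hh⟩ := ih
    -- The defect still to be written as `h ≫ d`. It lands in the cycles because of the homotopy
    -- relation one degree lower.
    let g : G.X k ⟶ G.X k := x ^ m • 𝟙 (G.X k) - G.d k ((ComplexShape.down ℕ).next k) ≫
        (if hi : (ComplexShape.down ℕ).next k + 1 = k then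
          h ((ComplexShape.down ℕ).next k) ≫ eqToHom (by rw [hi]) else 0)
    have hg : g ≫ G.d k ((ComplexShape.down ℕ).next k) = 0 := by
      cases k with
      | zero => simp
      | succ j =>
        have e := hh j (by simp)
        have hn : (ComplexShape.down ℕ).next (j + 1) = j := by simp
        simp only [g]
        rw [hn]
        simp only [dite_true, eqToHom_refl, Category.comp_id, Preadditive.sub_comp,
          Category.assoc]
        have e2 : h j ≫ G.d (j + 1) j = x ^ m • 𝟙 (G.X j) -
          G.d j ((ComplexShape.down ℕ).next j) ≫
        (if hi : (ComplexShape.down ℕ).next j + 1 = j then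
          h ((ComplexShape.down ℕ).next j) ≫ eqToHom (by rw [hi]) else 0) := by
          rw [← e]; abel
        rw [e2, Preadditive.comp_sub, ← Category.assoc, G.d_comp_d]
        simp
    obtain ⟨h', hh'⟩ := exists_lift_of_smul_homology_eq_zero G x k (hx k) g hg
    -- The old homotopies are rescaled by x so that all degrees share the exponent m + 1.
    refine ⟨m + 1, fun i => if hi : i = k then eqToHom (by rw [hi]) ≫ h' ≫ eqToHom (by rw [hi])
      else x • h i, fun i hi => ?_⟩
    have hne : ∀ i, i ≤ k → (ComplexShape.down ℕ).next i + 1 = i →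
      (ComplexShape.down ℕ).next i ≠ k := by
      intro i hi1 hi2 hi3; omega
    rcases Nat.lt_succ_iff_lt_or_eq.1 hi with hi | rfl
    · have e := hh i hi
      beta_reduce
      rw [dif_neg hi.ne, pow_succ', mul_smul, ← e]
      split_ifs with h1 h2
      · exact absurd h2 (hne i hi.le h1)
      · simp
      · simp
    · beta_reduce
      rw [dif_pos rfl]
      simp only [eqToHom_refl, Category.comp_id, Category.id_comp]
      rw [hh', pow_succ', mul_smul]
      simp only [g]
      split_ifs with h1 h2
      · exact absurd h2 (hne i le_rfl h1)
      · simp [smul_sub]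
      · simp

theorem exists_homotopy_pow_smul_id (G : ChainComplex (ModuleCat.{u} A) ℕ)
    (hbdd : IsBoundedComplex G)
    (hproj : ∀ i, Projective (G.X i)) (x : A) (hx : ∀ i, x • 𝟙 (G.homology i) = 0) :
    ∃ m : ℕ, Nonempty (Homotopy (x ^ m • 𝟙 G) 0) := by
  obtain ⟨s, hs⟩ := hbdd
  obtain ⟨m, h, hh⟩ := exists_contraction_up_to G hproj x hx (s + 1)
  let hom : ∀ i j, (ComplexShape.down ℕ).Rel j i → (G.X i ⟶ G.X j) := fun i j hij =>
    h i ≫ eqToHom (by rw [← (show i + 1 = j from hij)])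
  refine ⟨m, ⟨(Homotopy.ofEq ?_).trans (Homotopy.nullHomotopy' hom)⟩⟩
  ext i : 1
  by_cases hi : i < s + 1
  · have e := hh i hi
    cases i with
    | zero =>
      rw [Homotopy.nullHomotopicMap'_f_of_not_rel_left (k₁ := 1) (by simp) (by simp)]
      simp only [HomologicalComplex.smul_f_apply, HomologicalComplex.id_f]
      rw [← e]
      simp [hom]
    | succ j =>
      rw [Homotopy.nullHomotopicMap'_f (k₂ := j + 2) (k₀ := j) (by simp) (by simp)]
      simp only [HomologicalComplex.smul_f_apply, HomologicalComplex.id_f]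
      rw [← e]
      have hn : (ComplexShape.down ℕ).next (j + 1) = j := by simp
      rw [hn]
      simp [hom]
  · have := hs i (by omega)
    exact (ModuleCat.isZero_of_subsingleton (G.X i)).eq_of_src _ _

/-- Additive functors preserve homotopies, whereas annihilators of homology need not survive a
non-flat base change. This is why null-homotopic elements are used throughout. -/
theorem smul_homology_tensorComplex_eq_zero {B : Type u} [CommRing B] (φ : A →+* B)
    (M : ModuleCat.{u} B) (G : ChainComplex (ModuleCat.{u} A) ℕ) (x : A)
    (h : Homotopy (x • 𝟙 G) 0) (i : ℕ) :
    φ x • 𝟙 ((tensorComplex φ M G).homology i) = 0 := by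
  have h1 := ((ModuleCat.tensorAlong φ M).mapHomotopy h).homologyMap_eq i
  rw [Functor.map_zero, HomologicalComplex.homologyMap_zero] at h1
  refine Eq.trans ?_ h1
  have h2 : ((ModuleCat.tensorAlong φ M).mapHomologicalComplex (ComplexShape.down ℕ)).map
      (x • 𝟙 G) = tensorComplexMap φ (φ x • 𝟙 M) G := by
    ext j : 1
    refine ((ModuleCat.tensorAlong_map_smul φ M x (𝟙 (G.X j))).trans ?_).trans
      (ModuleCat.tensorAlongMap_smul_id φ M (φ x) (G.X j)).symm
    rw [CategoryTheory.Functor.map_id]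
  rw [h2]
  exact (homologyMap_tensorComplexMap_smul φ G M (φ x) i).symm

end NullHomotopy

/-! ### Growth of homology lengths -/

/-- A family of base changes `φ n : A → B` of a complex `G` of flat modules such that the `q n`-th
powers of the elements of a set `X` annihilate all homology modules `H_i(M ⊗ G)`, and the
homology of `B ⧸ P ⊗ G` is uniformly bounded for the primes `P` containing `X`. -/
structure PowerAnnihilatedFamily {A B : Type u} [CommRing A] [CommRing B] (φ : ℕ → A →+* B)
    (q : ℕ → ℕ) (X : Set B) (G : ChainComplex (ModuleCat.{u} A) ℕ) : Prop where
  flat : ∀ i, Module.Flat A (G.X i)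
  one_le : ∀ n, 1 ≤ q n
  pow_smul : ∀ x ∈ X, ∀ n (M : ModuleCat.{u} B) i,
    x ^ q n • 𝟙 ((tensorComplex (φ n) M G).homology i) = 0
  bounded : ∀ P : Ideal B, P.IsPrime → X ⊆ P →
    ∃ c : ℕ, ∀ n i, homologyLength (φ n) (ModuleCat.of B (B ⧸ P)) G i ≤ c

theorem mem_support_quotient_iff {B : Type*} [CommRing B] (I : Ideal B) (Q : PrimeSpectrum B) :
    Q ∈ Module.support B (B ⧸ I) ↔ I ≤ Q.asIdeal := by
  rw [Module.mem_support_iff_of_finite, Ideal.annihilator_quotient]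

section Subadditive

variable {A B : Type u} [CommRing A] [CommRing B] (φ : A →+* B)
  (G : ChainComplex (ModuleCat.{u} A) ℕ)
  {M₁ M₂ M₃ : Type u} [AddCommGroup M₁] [AddCommGroup M₂] [AddCommGroup M₃]
  [Module B M₁] [Module B M₂] [Module B M₃] (f : M₁ →ₗ[B] M₂) (g : M₂ →ₗ[B] M₃)

/-- The short complex of modules attached to an exact pair of linear maps. -/
def shortComplexOfExact (h : Function.Exact f g) : ShortComplex (ModuleCat.{u} B) :=
  ShortComplex.mk (ModuleCat.ofHom f) (ModuleCat.ofHom g) (by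
    ext x; exact h.apply_apply_eq_zero x)

theorem shortComplexOfExact_shortExact (h : Function.Exact f g) (hf : Function.Injective f)
    (hg : Function.Surjective g) : (shortComplexOfExact f g h).ShortExact :=
  ShortComplex.ShortExact.mk'
    ((ShortComplex.ShortExact.moduleCat_exact_iff_function_exact _).2 h)
    ((ModuleCat.mono_iff_injective _).2 hf) ((ModuleCat.epi_iff_surjective _).2 hg)

theorem homologyLength_le_add (h : Function.Exact f g) (hf : Function.Injective f)
    (hg : Function.Surjective g) (hG : ∀ i, Module.Flat A (G.X i)) (i : ℕ) :
    homologyLength φ (ModuleCat.of B M₂) G i ≤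
      homologyLength φ (ModuleCat.of B M₁) G i + homologyLength φ (ModuleCat.of B M₃) G i :=
  length_homology_le (tensorShortComplex_shortExact φ
    (shortComplexOfExact_shortExact f g h hf hg) G hG) i

/-- Multiplication by b is injective on the module but zero on homology, so the long exact sequence
embeds the homology of the module in that of its quotient by b. -/
theorem homologyLength_le_of_smul (hg : Function.Surjective g)
    (hG : ∀ i, Module.Flat A (G.X i)) (i : ℕ) (b : B)
    (f : M₂ →ₗ[B] M₂) (h : Function.Exact f g) (hf : Function.Injective f)
    (hfb : f = b • LinearMap.id)
    (hb : b • 𝟙 ((tensorComplex φ (ModuleCat.of B M₂) G).homology i) = 0) :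
    homologyLength φ (ModuleCat.of B M₂) G i ≤ homologyLength φ (ModuleCat.of B M₃) G i := by
  subst hfb
  refine length_homology_le_of_map_eq_zero (tensorShortComplex_shortExact φ
    (shortComplexOfExact_shortExact _ g h hf hg) G hG) i ?_
  exact (homologyMap_tensorComplexMap_smul φ G (ModuleCat.of B M₂) b i).trans hb

end Subadditive

section Bound

variable {A B : Type u} [CommRing A] [CommRing B]

theorem homologyLength_congr_equiv (φ : A →+* B) (G : ChainComplex (ModuleCat.{u} A) ℕ)
    {M N : Type u} [AddCommGroup M] [Module B M]
    [AddCommGroup N] [Module B N] (e : M ≃ₗ[B] N) (i : ℕ) :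
    homologyLength φ (ModuleCat.of B M) G i = homologyLength φ (ModuleCat.of B N) G i :=
  homologyLength_congr φ G e.toModuleIso i

/-- The exact sequence `0 → D/(x^j) → D/(x^(j+1)) → D/(x) → 0` bounds the homology of
`D/(x^j)`. -/
theorem homologyLength_quotient_pow_le (φ : A →+* B) (G : ChainComplex (ModuleCat.{u} A) ℕ)
    (hG : ∀ i, Module.Flat A (G.X i)) (P : Ideal B) [P.IsPrime] (x : B) (hx : x ∉ P) (i j : ℕ) :
    homologyLength φ (ModuleCat.of B (B ⧸ (P ⊔ Ideal.span {x ^ j}))) G i ≤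
      j * homologyLength φ (ModuleCat.of B (B ⧸ (P ⊔ Ideal.span {x}))) G i := by
  induction j with
  | zero =>
    have : Subsingleton (B ⧸ (P ⊔ Ideal.span {x ^ 0})) := by
      rw [Ideal.Quotient.subsingleton_iff]; simp
    have : Subsingleton (ModuleCat.of B (B ⧸ (P ⊔ Ideal.span {x ^ 0}))) := this
    rw [homologyLength_eq_zero_of_subsingleton_coeff]
    simp
  | succ j ih =>
    have hle : P ⊔ Ideal.span {x ^ j} ≤
        Submodule.comap (LinearMap.mulLeft B x) (P ⊔ Ideal.span {x ^ (j + 1)}) := by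
      rw [sup_le_iff]
      refine ⟨fun y hy => ?_, ?_⟩
      · exact Ideal.mem_sup_left (P.mul_mem_left x hy)
      · rw [Ideal.span_singleton_le_iff_mem]
        refine Ideal.mem_sup_right (Ideal.mem_span_singleton.2 ?_)
        simp [pow_succ']
    let f : (B ⧸ (P ⊔ Ideal.span {x ^ j})) →ₗ[B] (B ⧸ (P ⊔ Ideal.span {x ^ (j + 1)})) :=
      Submodule.mapQ _ _ (LinearMap.mulLeft B x) hle
    have hle' : P ⊔ Ideal.span {x ^ (j + 1)} ≤ P ⊔ Ideal.span {x} :=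
      sup_le_sup_left (Ideal.span_singleton_le_span_singleton.2 (dvd_pow_self x (by simp))) P
    let g : (B ⧸ (P ⊔ Ideal.span {x ^ (j + 1)})) →ₗ[B] (B ⧸ (P ⊔ Ideal.span {x})) :=
      Submodule.factor hle'
    have hg : Function.Surjective g := Submodule.factor_surjective hle'
    have hmem : ∀ (k : ℕ) (z : B), z ∈ P ⊔ Ideal.span {x ^ k} ↔ ∃ a ∈ P, ∃ b, z = a + x ^ k * b := by
      intro k z
      rw [Submodule.mem_sup]
      constructor
      · rintro ⟨a, ha, b, hb, rfl⟩
        obtain ⟨c, rfl⟩ := Ideal.mem_span_singleton.1 hb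
        exact ⟨a, ha, c, rfl⟩
      · rintro ⟨a, ha, b, rfl⟩
        exact ⟨a, ha, x ^ k * b, Ideal.mem_span_singleton.2 (dvd_mul_right _ _), rfl⟩
    have hf : Function.Injective f := by
      rw [← LinearMap.ker_eq_bot, LinearMap.ker_eq_bot']
      intro y hy
      obtain ⟨y, rfl⟩ := Submodule.Quotient.mk_surjective _ y
      have h1 : x * y ∈ P ⊔ Ideal.span {x ^ (j + 1)} := (Submodule.Quotient.mk_eq_zero _).1 hy
      rw [Submodule.Quotient.mk_eq_zero]
      -- From xy = a + x^(j+1) b with a in P, the prime P contains x(y - x^j b), hence y - x^j b.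
      obtain ⟨a, ha, b, hab⟩ := (hmem _ _).1 h1
      refine (hmem _ _).2 ⟨y - x ^ j * b, ?_, b, by ring⟩
      refine (‹P.IsPrime›.mem_or_mem (x := x) ?_).resolve_left hx
      have : x * (y - x ^ j * b) = a := by rw [mul_sub, hab]; ring
      rwa [this]
    have hex : Function.Exact f g := by
      intro y
      obtain ⟨y, rfl⟩ := Submodule.Quotient.mk_surjective _ y
      constructor
      · intro hy
        have h1 : y ∈ P ⊔ Ideal.span {x} := (Submodule.Quotient.mk_eq_zero _).1 hy
        rw [← pow_one x] at h1
        obtain ⟨a, ha, b, rfl⟩ := (hmem _ _).1 h1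
        refine ⟨Submodule.Quotient.mk b, ?_⟩
        change Submodule.Quotient.mk (x * b) = _
        rw [eq_comm, Submodule.Quotient.eq]
        exact Ideal.mem_sup_left (by simpa using ha)
      · rintro ⟨z, hz⟩
        obtain ⟨z, rfl⟩ := Submodule.Quotient.mk_surjective _ z
        rw [← hz]
        change Submodule.Quotient.mk (x * z) = 0
        rw [Submodule.Quotient.mk_eq_zero]
        exact Ideal.mem_sup_right (Ideal.mem_span_singleton.2 (dvd_mul_right _ _))
    refine (homologyLength_le_add φ G f g hex hf hg hG i).trans ?_
    push_cast
    rw [add_mul, one_mul]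
    gcongr

variable {φ : ℕ → A →+* B} {q : ℕ → ℕ} {X : Set B}
    {G : ChainComplex (ModuleCat.{u} A) ℕ} (F : PowerAnnihilatedFamily φ q X G)
include F

/-- The element x^(q n) is a nonzerodivisor on B/P and kills homology, so the homology of B/P embeds
in that of B/(P + x^(q n)), which is filtered by q n copies of B/(P + x). -/
theorem PowerAnnihilatedFamily.homologyLength_quotient_le (P : Ideal B) [P.IsPrime] (x : B)
    (hxX : x ∈ X) (hx : x ∉ P) (n i : ℕ) :
    homologyLength (φ n) (ModuleCat.of B (B ⧸ P)) G i ≤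
      q n * homologyLength (φ n) (ModuleCat.of B (B ⧸ (P ⊔ Ideal.span {x}))) G i := by
  refine le_trans ?_ (homologyLength_quotient_pow_le (φ n) G F.flat P x hx i (q n))
  have hle : P ≤ P ⊔ Ideal.span {x ^ q n} := le_sup_left
  refine homologyLength_le_of_smul (φ n) G (Submodule.factor hle) (Submodule.factor_surjective hle)
    F.flat i (x ^ q n) _ ?_ ?_ rfl (F.pow_smul x hxX n _ i)
  · intro y
    obtain ⟨y, rfl⟩ := Submodule.Quotient.mk_surjective _ y
    constructor
    · intro hy
      have h1 : y ∈ P ⊔ Ideal.span {x ^ q n} := (Submodule.Quotient.mk_eq_zero _).1 hy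
      obtain ⟨a, ha, b, hb, rfl⟩ := Submodule.mem_sup.1 h1
      obtain ⟨c, rfl⟩ := Ideal.mem_span_singleton.1 hb
      refine ⟨Submodule.Quotient.mk c, ?_⟩
      change Submodule.Quotient.mk (x ^ q n * c) = _
      rw [eq_comm, Submodule.Quotient.eq]
      simpa using ha
    · rintro ⟨z, hz⟩
      obtain ⟨z, rfl⟩ := Submodule.Quotient.mk_surjective _ z
      rw [← hz]
      change Submodule.Quotient.mk (x ^ q n * z) = 0
      rw [Submodule.Quotient.mk_eq_zero]
      exact Ideal.mem_sup_right (Ideal.mem_span_singleton.2 (dvd_mul_right _ _))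
  · rw [← LinearMap.ker_eq_bot, LinearMap.ker_eq_bot']
    intro y hy
    obtain ⟨y, rfl⟩ := Submodule.Quotient.mk_surjective _ y
    have h1 : x ^ q n * y ∈ P := (Submodule.Quotient.mk_eq_zero _).1 hy
    rw [Submodule.Quotient.mk_eq_zero]
    exact (‹P.IsPrime›.mem_or_mem h1).resolve_left fun h => hx (‹P.IsPrime›.mem_of_pow_mem _ h)

/-- The lengths of the homology modules of `M ⊗ G` grow at most like `q ^ dim M`. -/
theorem PowerAnnihilatedFamily.exists_homologyLength_le [IsNoetherianRing B] (e : ℕ) :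
    ∀ (M : Type u) [AddCommGroup M] [Module B M] [Module.Finite B M],
      (∀ P ∈ Module.support B M, Order.coheight P < e) →
      ∃ c : ℕ, ∀ n i, homologyLength (φ n) (ModuleCat.of B M) G i * q n ≤ c * (q n) ^ e := by
  -- The extra factor `q n` on the left stands for the exponent e - 1 without subtraction: e is one
  -- more than the allowed dimension of the support, and e = 0 forces M = 0.
  induction e with
  | zero =>
    intro M _ _ _ hM
    have : Subsingleton M := by
      rw [← Module.support_eq_empty_iff (R := B), Set.eq_empty_iff_forall_notMem]
      intro P hP
      simpa using hM P hP
    have : Subsingleton (ModuleCat.of B M) := this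
    exact ⟨0, fun n i => by rw [homologyLength_eq_zero_of_subsingleton_coeff]; simp⟩
  | succ e ih =>
    intro M _ _ hfin
    induction hfin using IsNoetherianRing.induction_on_isQuotientEquivQuotientPrime B with
    | subsingleton N =>
      intro _
      have : Subsingleton (ModuleCat.of B N) := ‹_›
      exact ⟨0, fun n i => by rw [homologyLength_eq_zero_of_subsingleton_coeff]; simp⟩
    | quotient N P eq =>
      intro hN
      have hPp := P.2
      simp only [homologyLength_congr_equiv _ G eq]
      -- Either P contains X and the homology is uniformly bounded, or some x in X lies outside P
      -- and B/(P + x) has smaller dimension.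
      by_cases hX : X ⊆ P.asIdeal
      · obtain ⟨c, hc⟩ := F.bounded P.asIdeal P.2 hX
        refine ⟨c, fun n i => ?_⟩
        rw [pow_succ, ← mul_assoc]
        gcongr
        refine (hc n i).trans ?_
        have := Nat.one_le_pow e (q n) (F.one_le n)
        exact_mod_cast Nat.le_mul_of_pos_right c this
      · obtain ⟨x, hxX, hx⟩ := Set.not_subset.1 hX
        obtain ⟨c, hc⟩ := ih (B ⧸ (P.asIdeal ⊔ Ideal.span {x})) (by
          intro Q hQ
          rw [mem_support_quotient_iff] at hQ
          have hPQ : P < Q := by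
            refine lt_of_le_of_ne (le_sup_left.trans hQ) ?_
            rintro rfl
            exact hx (hQ (Ideal.mem_sup_right (Ideal.mem_span_singleton_self x)))
          have h1 : Order.coheight P < (e + 1 : ℕ) := by
            refine hN P ?_
            rw [eq.support_eq, mem_support_quotient_iff]
          have h2 := Order.coheight_add_one_le hPQ
          have h3 : Order.coheight Q + 1 < (e : ℕ∞) + 1 := by
            refine h2.trans_lt ?_
            exact_mod_cast h1
          exact lt_of_add_lt_add_right h3)
        refine ⟨c, fun n i => ?_⟩
        calc _ ≤ (q n * homologyLength (φ n) (ModuleCat.of B (B ⧸ (P.asIdeal ⊔ Ideal.span {x}))) G i)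
              * q n := by
              gcongr
              exact F.homologyLength_quotient_le P.asIdeal x hxX hx n i
          _ = q n * (homologyLength (φ n) (ModuleCat.of B (B ⧸ (P.asIdeal ⊔ Ideal.span {x}))) G i
              * q n) := by ring
          _ ≤ q n * (c * (q n) ^ e) := mul_le_mul' le_rfl (hc n i)
          _ = c * (q n) ^ (e + 1) := by ring
    | exact N₁ N₂ N₃ f g hf hg hfg h1 h3 =>
      intro hN
      have hs := Module.support_of_exact hfg hf hg
      obtain ⟨c1, hc1⟩ := h1 fun P hP => hN P (hs ▸ Or.inl hP)
      obtain ⟨c3, hc3⟩ := h3 fun P hP => hN P (hs ▸ Or.inr hP)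
      refine ⟨c1 + c3, fun n i => ?_⟩
      calc _ ≤ (homologyLength (φ n) (ModuleCat.of B N₁) G i +
            homologyLength (φ n) (ModuleCat.of B N₃) G i) * q n := by
              gcongr
              exact homologyLength_le_add (φ n) G f g hfg hf hg F.flat i
        _ ≤ _ := by
          push_cast
          rw [add_mul, add_mul]
          exact add_le_add (hc1 n i) (hc3 n i)

end Bound

/-! ### Euler characteristics up to lower order terms -/

/-- A finite module over a domain contains a free submodule of the same rank with torsion
quotient. -/
theorem exists_free_submodule_torsion_quotient (D N : Type*) [CommRing D] [IsDomain D]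
    [AddCommGroup N] [Module D N] [Module.Finite D N] :
    ∃ j : (Fin (Module.finrank D N) → D) →ₗ[D] N, Function.Injective j ∧
      ∃ t : D, t ≠ 0 ∧ ∀ y : N, t • y ∈ LinearMap.range j := by
  obtain ⟨f, hf⟩ := exists_linearIndependent_of_le_finrank (R := D) (M := N) le_rfl
  refine ⟨Fintype.linearCombination D f, hf.fintypeLinearCombination_injective, ?_⟩
  · have hspan : LinearMap.range (Fintype.linearCombination D f) = Submodule.span D (Set.range f) :=
      Fintype.range_linearCombination D f
    have h1 := Submodule.finrank_quotient_add_finrank (Submodule.span D (Set.range f))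
    rw [finrank_span_eq_card hf, Fintype.card_fin] at h1
    have h2 := Module.finrank_eq_zero_iff.1 (Nat.add_eq_right.1 h1)
    obtain ⟨s, hs⟩ := (Module.Finite.fg_top : (⊤ : Submodule D N).FG)
    choose a ha0 ha using fun y : N => h2 (Submodule.Quotient.mk y)
    -- The common multiplier is the product, over a finite generating set, of elements moving each
    -- generator into the free submodule.
    refine ⟨∏ y ∈ s, a y, Finset.prod_ne_zero_iff.2 fun y _ => ha0 y, fun y => ?_⟩
    rw [hspan]
    have hy : y ∈ Submodule.span D (s : Set N) := hs ▸ Submodule.mem_top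
    induction hy using Submodule.span_induction with
    | mem x hx =>
      obtain ⟨b, hb⟩ := Finset.dvd_prod_of_mem a hx
      rw [hb, mul_comm, mul_smul]
      refine Submodule.smul_mem _ _ ?_
      rw [← Submodule.Quotient.mk_eq_zero, Submodule.Quotient.mk_smul]
      exact ha x
    | zero => simp
    | add x y _ _ h1 h2 => rw [smul_add]; exact add_mem h1 h2
    | smul c x _ h => rw [smul_comm]; exact Submodule.smul_mem _ _ h

section EulerChar

variable {A B : Type u} [CommRing A] [CommRing B]

/-- The Euler characteristic of `M ⊗_A G`. -/
def tensorChi (φ : A →+* B) (G : ChainComplex (ModuleCat.{u} A) ℕ) (M : Type u) [AddCommGroup M]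
    [Module B M] : ℤ :=
  eulerChar B (tensorComplex φ (ModuleCat.of B M) G)

theorem tensorChi_congr (φ : A →+* B) (G : ChainComplex (ModuleCat.{u} A) ℕ) {M N : Type u}
    [AddCommGroup M] [Module B M] [AddCommGroup N] [Module B N] (e : M ≃ₗ[B] N) :
    tensorChi φ G M = tensorChi φ G N :=
  eulerChar_eq_of_iso (tensorComplexIso φ e.toModuleIso G)

theorem tensorChi_eq_zero (φ : A →+* B) (G : ChainComplex (ModuleCat.{u} A) ℕ) (M : Type u)
    [AddCommGroup M] [Module B M] [Subsingleton M] : tensorChi φ G M = 0 := by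
  have : Subsingleton (ModuleCat.of B M) := ‹_›
  have h := eulerChar_eq_sum (tensorComplex φ (ModuleCat.of B M) G) 0 fun i _ =>
    homologyLength_eq_zero_of_subsingleton_coeff φ G (ModuleCat.of B M) i
  exact h.trans (by simp)

variable {φ : ℕ → A →+* B} {q : ℕ → ℕ} {X : Set B}
  {G : ChainComplex (ModuleCat.{u} A) ℕ} (F : PowerAnnihilatedFamily φ q X G)
  [IsNoetherianRing B]
include F

/-- The growth bound is finite and `q n` is nonzero, so it already excludes infinite length. -/
theorem PowerAnnihilatedFamily.homologyLength_ne_top {d : ℕ}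
    (hd : ∀ P : PrimeSpectrum B, Order.coheight P < d)
    (M : Type u) [AddCommGroup M] [Module B M] [Module.Finite B M] (n i : ℕ) :
    homologyLength (φ n) (ModuleCat.of B M) G i ≠ ⊤ := by
  obtain ⟨c, hc⟩ := F.exists_homologyLength_le d M fun P _ => hd P
  intro h
  have h1 := hc n i
  have h2 : ((q n : ℕ) : ℕ∞) ≠ 0 := by
    have := F.one_le n
    exact_mod_cast (by omega : q n ≠ 0)
  rw [h, ENat.top_mul h2, top_le_iff] at h1
  exact (ENat.natCast_ne_top (c * (q n) ^ d)) (by exact_mod_cast h1)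

theorem PowerAnnihilatedFamily.tensorChi_add (hbdd : IsBoundedComplex G) {d : ℕ}
    (hd : ∀ P : PrimeSpectrum B, Order.coheight P < d)
    {M₁ M₂ M₃ : Type u} [AddCommGroup M₁] [AddCommGroup M₂] [AddCommGroup M₃]
    [Module B M₁] [Module B M₂] [Module B M₃] [Module.Finite B M₁] [Module.Finite B M₃]
    (f : M₁ →ₗ[B] M₂) (g : M₂ →ₗ[B] M₃)
    (hf : Function.Injective f) (hg : Function.Surjective g) (h : Function.Exact f g) (n : ℕ) :
    tensorChi (φ n) G M₂ = tensorChi (φ n) G M₁ + tensorChi (φ n) G M₃ := by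
  obtain ⟨s, hs⟩ := hbdd
  have hz : ∀ (M : ModuleCat.{u} B) i, s + 1 ≤ i → homologyLength (φ n) M G i = 0 :=
    fun M i hi => by
    have := hs i (by omega)
    exact homologyLength_eq_zero_of_subsingleton _ _ _ _
  let S := tensorShortComplex (φ n) (shortComplexOfExact f g h) G
  have hS : S.ShortExact := tensorShortComplex_shortExact (φ n)
    (shortComplexOfExact_shortExact f g h hf hg) G F.flat
  have f1' : ∀ i, homologyLength (φ n) (ModuleCat.of B M₁) G i ≠ ⊤ :=
    fun i => F.homologyLength_ne_top hd M₁ n i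
  have f3' : ∀ i, homologyLength (φ n) (ModuleCat.of B M₃) G i ≠ ⊤ :=
    fun i => F.homologyLength_ne_top hd M₃ n i
  have f1 : ∀ i, Module.length B (S.X₁.homology i) ≠ ⊤ := f1'
  have f3 : ∀ i, Module.length B (S.X₃.homology i) ≠ ⊤ := f3'
  have h1 : ∀ i, s + 1 ≤ i → Module.length B (S.X₁.homology i) = 0 := hz (ModuleCat.of B M₁)
  have h3 : ∀ i, s + 1 ≤ i → Module.length B (S.X₃.homology i) = 0 := hz (ModuleCat.of B M₃)
  have key := eulerChar_add_of_shortExact hS (s + 1) f1 f3 h1 h3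
  exact key

theorem PowerAnnihilatedFamily.exists_abs_tensorChi_le (hbdd : IsBoundedComplex G) (e : ℕ)
    (M : Type u) [AddCommGroup M] [Module B M] [Module.Finite B M]
    (hM : ∀ P ∈ Module.support B M, Order.coheight P < e) :
    ∃ c : ℕ, ∀ n, |tensorChi (φ n) G M| * q n ≤ c * (q n) ^ e := by
  obtain ⟨s, hs⟩ := hbdd
  obtain ⟨c, hc⟩ := F.exists_homologyLength_le e M hM
  refine ⟨(s + 1) * c, fun n => ?_⟩
  have hz : ∀ i, s + 1 ≤ i → homologyLength (φ n) (ModuleCat.of B M) G i = 0 := fun i hi => by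
    have := hs i (by omega)
    exact homologyLength_eq_zero_of_subsingleton _ _ _ _
  have h1 : ∀ i, (homologyLength (φ n) (ModuleCat.of B M) G i).toNat * q n ≤ c * (q n) ^ e :=
    fun i => by
    have h2 := hc n i
    have h3 := ENat.toNat_le_toNat h2 (by exact_mod_cast ENat.natCast_ne_top (c * (q n) ^ e))
    rw [ENat.toNat_mul] at h3
    exact_mod_cast h3
  have h4 := eulerChar_eq_sum (tensorComplex (φ n) (ModuleCat.of B M) G) (s + 1) hz
  unfold tensorChi
  rw [h4]
  calc _ ≤ (∑ i ∈ Finset.range (s + 1),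
        ((homologyLength (φ n) (ModuleCat.of B M) G i).toNat : ℤ)) * q n := by
        gcongr
        refine (Finset.abs_sum_le_sum_abs _ _).trans (Finset.sum_le_sum fun i _ => ?_)
        rw [abs_mul, abs_pow, abs_neg, abs_one, one_pow, one_mul, Nat.abs_cast]
        exact le_rfl
    _ = ∑ i ∈ Finset.range (s + 1),
        (((homologyLength (φ n) (ModuleCat.of B M) G i).toNat * q n : ℕ) : ℤ) := by
        rw [Finset.sum_mul]; push_cast; rfl
    _ ≤ ∑ i ∈ Finset.range (s + 1), ((c * (q n) ^ e : ℕ) : ℤ) :=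
        Finset.sum_le_sum fun i _ => by exact_mod_cast h1 i
    _ = _ := by
        rw [Finset.sum_const, Finset.card_range]; push_cast; ring

theorem PowerAnnihilatedFamily.tensorChi_pi (hbdd : IsBoundedComplex G) {d : ℕ}
    (hd : ∀ P : PrimeSpectrum B, Order.coheight P < d)
    (M : Type u) [AddCommGroup M] [Module B M] [Module.Finite B M] (ρ n : ℕ) :
    tensorChi (φ n) G (Fin ρ → M) = ρ * tensorChi (φ n) G M := by
  induction ρ with
  | zero => simp [tensorChi_eq_zero]
  | succ ρ ih =>
    rw [tensorChi_congr (φ n) G (Fin.consLinearEquiv B (fun _ : Fin (ρ + 1) => M)).symm,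
      F.tensorChi_add hbdd hd (LinearMap.inl B M (Fin ρ → M)) (LinearMap.snd B M (Fin ρ → M))
        LinearMap.inl_injective Prod.snd_surjective Function.Exact.inl_snd, ih]
    push_cast; ring

/-- If `D` is a quotient domain of `B` and `N` is a finite `D`-module of rank `ρ`, then
`χ(N ⊗ G)` and `ρ χ(D ⊗ G)` agree up to lower order terms. -/
theorem PowerAnnihilatedFamily.exists_abs_tensorChi_sub_le (hbdd : IsBoundedComplex G) {d : ℕ}
    (hd : ∀ P : PrimeSpectrum B, Order.coheight P < d + 1)
    (D N : Type u) [CommRing D] [IsDomain D] [Algebra B D]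
    (hsurj : Function.Surjective (algebraMap B D))
    [AddCommGroup N] [Module B N] [Module D N] [IsScalarTower B D N] [Module.Finite D N] :
    ∃ c : ℕ, ∀ n, |tensorChi (φ n) G N - Module.finrank D N * tensorChi (φ n) G D| * q n ≤
      c * (q n) ^ d := by
  obtain ⟨j, hj, t, ht, htr⟩ := exists_free_submodule_torsion_quotient D N
  have hfD : Module.Finite B D := Module.Finite.of_surjective (Algebra.linearMap B D) hsurj
  have hfN : Module.Finite B N := Module.Finite.trans D N
  let jB := j.restrictScalars B
  -- The cokernel is killed by t ≠ 0 in D, so every prime in its support strictly contains the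
  -- kernel of B → D.
  have hsup : ∀ P ∈ Module.support B (N ⧸ LinearMap.range jB), Order.coheight P < d := by
    intro P hP
    rw [Module.mem_support_iff_of_finite] at hP
    obtain ⟨t', rfl⟩ := hsurj t
    have hker : RingHom.ker (algebraMap B D) < P.asIdeal := by
      refine lt_of_le_of_ne (fun b hb => hP ?_) fun h => ?_
      · rw [Module.mem_annihilator]
        intro y
        obtain ⟨y, rfl⟩ := Submodule.Quotient.mk_surjective _ y
        rw [← Submodule.Quotient.mk_smul, ← algebraMap_smul D b y, (RingHom.mem_ker).1 hb, zero_smul,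
          Submodule.Quotient.mk_zero]
      · have : t' ∈ P.asIdeal := hP (by
          rw [Module.mem_annihilator]
          intro y
          obtain ⟨y, rfl⟩ := Submodule.Quotient.mk_surjective _ y
          rw [← Submodule.Quotient.mk_smul, Submodule.Quotient.mk_eq_zero, ← algebraMap_smul D t' y]
          exact htr y)
        rw [← h, RingHom.mem_ker] at this
        exact ht this
    let P0 : PrimeSpectrum B := ⟨RingHom.ker (algebraMap B D), RingHom.ker_isPrime _⟩
    have hlt : P0 < P := hker
    have h3 : Order.coheight P + 1 < (d : ℕ∞) + 1 := (Order.coheight_add_one_le hlt).trans_lt (hd P0)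
    exact lt_of_add_lt_add_right h3
  have hjex : Function.Exact jB (LinearMap.range jB).mkQ := LinearMap.exact_map_mkQ_range jB
  obtain ⟨c, hc⟩ := F.exists_abs_tensorChi_le hbdd d (N ⧸ LinearMap.range jB) hsup
  refine ⟨c, fun n => ?_⟩
  have hd' : ∀ P : PrimeSpectrum B, Order.coheight P < (d + 1 : ℕ) := by exact_mod_cast hd
  have h1 := F.tensorChi_add hbdd hd' jB (LinearMap.range jB).mkQ hj
    (Submodule.mkQ_surjective _) hjex n
  rw [h1, F.tensorChi_pi hbdd hd' D, add_sub_cancel_left]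
  exact hc n

end EulerChar

/-! ### Lengths under change of rings -/

section ChangeOfRings

variable {A B : Type u} [CommRing A] [CommRing B]

instance extendScalars_preservesFiniteColimits (ψ : A →+* B) :
    Limits.PreservesFiniteColimits (ModuleCat.extendScalars.{u, u, u} ψ) := by
  have := (ModuleCat.extendRestrictScalarsAdj.{u, u, u} ψ).leftAdjoint_preservesColimits
  infer_instance

theorem length_homology_restrictScalars (g : A →+* B) (C : ChainComplex (ModuleCat.{u} B) ℕ)
    (i : ℕ) :
    Module.length A ((((ModuleCat.restrictScalars.{u} g).mapHomologicalComplex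
      (ComplexShape.down ℕ)).obj C).homology i) =
    Module.length A ((ModuleCat.restrictScalars.{u} g).obj (C.homology i)) :=
  (((C.sc i).mapHomologyIso (ModuleCat.restrictScalars.{u} g)).toLinearEquiv).length_eq

theorem length_homology_baseChange_of_flat (ψ : A →+* B) (hψ : ψ.Flat)
    (C : ChainComplex (ModuleCat.{u} A) ℕ) (i : ℕ) :
    Module.length B ((baseChange ψ C).homology i) =
    Module.length B ((ModuleCat.extendScalars.{u, u, u} ψ).obj (C.homology i)) := by
  have := ModuleCat.preservesFiniteLimits_extendScalars_of_flat hψ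
  exact (((C.sc i).mapHomologyIso (ModuleCat.extendScalars.{u, u, u} ψ)).toLinearEquiv).length_eq

/-- Base change along a composition. -/
def baseChangeComp {C : Type u} [CommRing C] (f : A →+* B) (g : B →+* C)
    (G : ChainComplex (ModuleCat.{u} A) ℕ) :
    baseChange (g.comp f) G ≅ baseChange g (baseChange f G) :=
  (NatIso.mapHomologicalComplex (ModuleCat.extendScalarsComp f g) (ComplexShape.down ℕ)).app G

/-- Base change along the identity. -/
def baseChangeId (G : ChainComplex (ModuleCat.{u} A) ℕ) : baseChange (RingHom.id A) G ≅ G :=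
  (NatIso.mapHomologicalComplex (ModuleCat.extendScalarsId.{u, u} A) (ComplexShape.down ℕ)).app G ≪≫
    (Functor.mapHomologicalComplexIdIso _ _).app G

/-- Finite length modules are supported at maximal ideals. -/
theorem isMaximal_of_mem_support_of_isFiniteLength {N : Type*} [AddCommGroup N] [Module A N]
    (hN : IsFiniteLength A N) (P : PrimeSpectrum A) (hP : P ∈ Module.support A N) :
    P.asIdeal.IsMaximal := by
  induction hN with
  | of_subsingleton =>
    rw [Module.support_eq_empty] at hP
    exact absurd hP (Set.notMem_empty _)
  | @of_simple_quotient M _ _ N _ _ ih =>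
    rw [Module.support_of_exact (LinearMap.exact_subtype_mkQ N) N.injective_subtype
      N.mkQ_surjective] at hP
    rcases hP with hP | hP
    · exact ih hP
    · obtain ⟨I, hI, ⟨e⟩⟩ := isSimpleModule_iff_quot_maximal.1 ‹IsSimpleModule A (M ⧸ N)›
      rw [e.support_eq, mem_support_quotient_iff] at hP
      rwa [← hI.eq_of_le P.2.ne_top hP]

/-- Lengths of finite length modules are preserved by a family of flat base changes which
together preserve the lengths of the simple modules. -/
theorem sum_length_extendScalars {ι : Type*} [Fintype ι] {T : ι → Type u}
    [∀ j, CommRing (T j)] (ψ : ∀ j, A →+* T j) (hψ : ∀ j, (ψ j).Flat) {N : Type u}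
    [AddCommGroup N] [Module A N] (hN : IsFiniteLength A N)
    (h : ∀ m : Ideal A, m.IsMaximal → (∀ hm : m.IsPrime, ⟨m, hm⟩ ∈ Module.support A N) →
      ∑ j, Module.length (T j) ((ModuleCat.extendScalars.{u, u, u} (ψ j)).obj
        (ModuleCat.of A (A ⧸ m))) = 1) :
    ∑ j, Module.length (T j) ((ModuleCat.extendScalars.{u, u, u} (ψ j)).obj (ModuleCat.of A N)) =
      Module.length A N := by
  induction hN with
  | @of_subsingleton M _ _ _ =>
    rw [Module.length_eq_zero, Finset.sum_eq_zero]
    intro j _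
    have : Subsingleton ((ModuleCat.extendScalars.{u, u, u} (ψ j)).obj (ModuleCat.of A M)) :=
      inferInstanceAs (Subsingleton (TensorProduct A ((ModuleCat.restrictScalars (ψ j)).obj
        (ModuleCat.of (T j) (T j))) M))
    exact Module.length_eq_zero
  | @of_simple_quotient M _ _ N _ hN ih =>
    have hs := Module.support_of_exact (LinearMap.exact_subtype_mkQ N) N.injective_subtype
      N.mkQ_surjective
    have hSE := shortComplexOfExact_shortExact N.subtype N.mkQ (LinearMap.exact_subtype_mkQ N)
      N.injective_subtype N.mkQ_surjective
    have hadd : ∀ j, Module.length (T j) ((ModuleCat.extendScalars.{u, u, u} (ψ j)).obj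
        (ModuleCat.of A M)) = Module.length (T j) ((ModuleCat.extendScalars.{u, u, u} (ψ j)).obj
        (ModuleCat.of A N)) + Module.length (T j) ((ModuleCat.extendScalars.{u, u, u} (ψ j)).obj
        (ModuleCat.of A (M ⧸ N))) := by
      intro j
      have := ModuleCat.preservesFiniteLimits_extendScalars_of_flat (hψ j)
      have h1 := hSE.map_of_exact (ModuleCat.extendScalars.{u, u, u} (ψ j))
      exact Module.length_eq_add_of_exact _ _ ((ModuleCat.mono_iff_injective _).1 h1.mono_f)
        ((ModuleCat.epi_iff_surjective _).1 h1.epi_g)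
        ((ShortComplex.ShortExact.moduleCat_exact_iff_function_exact _).1 h1.exact)
    rw [Finset.sum_congr rfl fun j _ => hadd j, Finset.sum_add_distrib,
      ih fun m hm hms => h m hm fun hp => hs ▸ Or.inl (hms hp)]
    obtain ⟨I, hI, ⟨e⟩⟩ := isSimpleModule_iff_quot_maximal.1 ‹IsSimpleModule A (M ⧸ N)›
    have h2 : ∑ j, Module.length (T j) ((ModuleCat.extendScalars.{u, u, u} (ψ j)).obj
        (ModuleCat.of A (M ⧸ N))) = 1 := by
      rw [← h I hI fun hp => hs ▸ Or.inr (by rw [e.support_eq, mem_support_quotient_iff])]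
      exact Finset.sum_congr rfl fun j _ => ((ModuleCat.extendScalars.{u, u, u} (ψ j)).mapIso
        e.toModuleIso).toLinearEquiv.length_eq
    rw [h2, Module.length_eq_add_of_exact N.subtype N.mkQ N.injective_subtype
      N.mkQ_surjective (LinearMap.exact_subtype_mkQ N), Module.length_eq_one A (M ⧸ N)]

/-- Restriction of scalars preserves lengths if it preserves lengths of simple modules. -/
theorem length_restrictScalars_eq (g : A →+* B)
    (h : ∀ m : Ideal B, m.IsMaximal → Module.length A ((ModuleCat.restrictScalars.{u} g).obj
      (ModuleCat.of B (B ⧸ m))) = 1) {N : Type u} [AddCommGroup N] [Module B N]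
    (hN : IsFiniteLength B N) :
    Module.length A ((ModuleCat.restrictScalars.{u} g).obj (ModuleCat.of B N)) =
      Module.length B N := by
  induction hN with
  | @of_subsingleton M _ _ _ =>
    have : Subsingleton ((ModuleCat.restrictScalars.{u} g).obj (ModuleCat.of B M)) := ‹_›
    rw [Module.length_eq_zero, Module.length_eq_zero]
  | @of_simple_quotient M _ _ N _ hN ih =>
    have hSE := shortComplexOfExact_shortExact N.subtype N.mkQ (LinearMap.exact_subtype_mkQ N)
      N.injective_subtype N.mkQ_surjective
    have h1 := hSE.map_of_exact (ModuleCat.restrictScalars.{u} g)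
    have h2 : Module.length A ((ModuleCat.restrictScalars.{u} g).obj (ModuleCat.of B M)) =
        Module.length A ((ModuleCat.restrictScalars.{u} g).obj (ModuleCat.of B N)) +
        Module.length A ((ModuleCat.restrictScalars.{u} g).obj (ModuleCat.of B (M ⧸ N))) :=
      Module.length_eq_add_of_exact _ _ ((ModuleCat.mono_iff_injective _).1 h1.mono_f)
        ((ModuleCat.epi_iff_surjective _).1 h1.epi_g)
        ((ShortComplex.ShortExact.moduleCat_exact_iff_function_exact _).1 h1.exact)
    obtain ⟨I, hI, ⟨e⟩⟩ := isSimpleModule_iff_quot_maximal.1 ‹IsSimpleModule B (M ⧸ N)›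
    have h3 : Module.length A ((ModuleCat.restrictScalars.{u} g).obj (ModuleCat.of B (M ⧸ N))) =
        1 := by
      rw [← h I hI]
      exact ((ModuleCat.restrictScalars.{u} g).mapIso e.toModuleIso).toLinearEquiv.length_eq
    rw [h2, h3, ih, Module.length_eq_add_of_exact N.subtype N.mkQ N.injective_subtype
      N.mkQ_surjective (LinearMap.exact_subtype_mkQ N), Module.length_eq_one B (M ⧸ N)]

theorem length_restrictScalars_of_surjective (g : A →+* B) (hg : Function.Surjective g)
    (N : ModuleCat.{u} B) :
    Module.length A ((ModuleCat.restrictScalars.{u} g).obj N) = Module.length B N := by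
  let := g.toAlgebra
  let : Module A N := Module.compHom N g
  have : IsScalarTower A B N := ⟨fun a b n => by
    rw [Algebra.smul_def, mul_smul]; rfl⟩
  exact Module.length_eq_of_surjective (S := A) (R := B) (M := N) hg

/-- Present M as a quotient of a finite free module with finite kernel N. Degree i + 1 for M is
controlled by degree i + 1 for the free module and degree i for N, so induction on the degree
applies to all M at once; degree 0 is right exact. -/
theorem homologyLength_ne_top_of_finite [IsNoetherianRing A] (G : ChainComplex (ModuleCat.{u} A) ℕ)
    (hG : ∀ i, Module.Flat A (G.X i)) (hfin : ∀ i, Module.length A (G.homology i) ≠ ⊤) (i : ℕ) :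
    ∀ (M : Type u) [AddCommGroup M] [Module A M] [Module.Finite A M],
    homologyLength (RingHom.id A) (ModuleCat.of A M) G i ≠ ⊤ := by
  have hpi : ∀ (i r : ℕ), homologyLength (RingHom.id A) (ModuleCat.of A (Fin r → A)) G i ≠ ⊤ := by
    intro i r
    induction r with
    | zero =>
      have : Subsingleton (ModuleCat.of A (Fin 0 → A)) :=
        inferInstanceAs (Subsingleton (Fin 0 → A))
      rw [homologyLength_eq_zero_of_subsingleton_coeff]; simp
    | succ r ih =>
      rw [homologyLength_congr_equiv (RingHom.id A) G
        (Fin.consLinearEquiv A (fun _ : Fin (r + 1) => A)).symm]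
      refine ne_top_of_le_ne_top ?_ (homologyLength_le_add (RingHom.id A) G
        (LinearMap.inl A A (Fin r → A)) (LinearMap.snd A A (Fin r → A))
        Function.Exact.inl_snd LinearMap.inl_injective Prod.snd_surjective hG i)
      refine WithTop.add_ne_top.2 ⟨?_, ih⟩
      have := length_homology_eq_of_iso (baseChangeId G) i
      exact ne_of_eq_of_ne this (hfin i)
  have hpres : ∀ (M : Type u) [AddCommGroup M] [Module A M] [Module.Finite A M],
      ∃ (r : ℕ) (g : (Fin r → A) →ₗ[A] M), Function.Surjective g := fun M _ _ _ =>
    Module.Finite.exists_fin' A M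
  induction i with
  | zero =>
    intro M _ _ _
    obtain ⟨r, g, hg⟩ := hpres M
    let S := tensorShortComplex (RingHom.id A) (shortComplexOfExact (LinearMap.ker g).subtype g
      (LinearMap.exact_subtype_ker_map g)) G
    have hS : S.ShortExact := tensorShortComplex_shortExact _ (shortComplexOfExact_shortExact _ _
      (LinearMap.exact_subtype_ker_map g) (Submodule.injective_subtype _) hg) G hG
    have h1 := Module.length_le_of_surjective _ (surjective_homologyMap_zero hS)
    exact ne_top_of_le_ne_top (hpi 0 r) h1
  | succ i ih =>
    intro M _ _ _
    obtain ⟨r, g, hg⟩ := hpres M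
    let S := tensorShortComplex (RingHom.id A) (shortComplexOfExact (LinearMap.ker g).subtype g
      (LinearMap.exact_subtype_ker_map g)) G
    have hS : S.ShortExact := tensorShortComplex_shortExact _ (shortComplexOfExact_shortExact _ _
      (LinearMap.exact_subtype_ker_map g) (Submodule.injective_subtype _) hg) G hG
    have h1 := length_le_add_of_exact _ _ (exact_delta_right hS i)
    have h2 := ih (LinearMap.ker g)
    exact ne_top_of_le_ne_top (WithTop.add_ne_top.2 ⟨hpi (i + 1) r, h2⟩) h1

end ChangeOfRings

/-! ### Iterated Frobenius as a power-annihilated family -/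

section Frobenius

/-- Iterating the Frobenius functor is base change along the iterated Frobenius. -/
def frobeniusFunctorIterIso (p : ℕ) (B : Type u) [CommRing B] [Fact p.Prime] [CharP B p] (n : ℕ)
    (C : ChainComplex (ModuleCat.{u} B) ℕ) :
    (frobeniusFunctor p B)^[n] C ≅ baseChange (iterateFrobenius B p n) C := by
  induction n generalizing C with
  | zero =>
    exact (baseChangeId C).symm ≪≫ eqToIso (by rw [iterateFrobenius_zero])
  | succ n ih =>
    exact ih (frobeniusFunctor p B C) ≪≫ (baseChangeComp _ _ C).symm ≪≫ eqToIso (by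
      congr 1
      ext x
      simp [iterateFrobenius_def, frobenius_def, pow_succ', ← pow_mul])

variable {A B : Type u} [CommRing A] [CommRing B] (p : ℕ) [Fact p.Prime] [CharP A p] [CharP B p]
  (f : A →+* B)

/-- The iterated Frobenius of `A` followed by `f : A → B`. -/
def frobeniusComp (n : ℕ) : A →+* B := f.comp (iterateFrobenius A p n)

omit [CharP B p] in
theorem frobeniusComp_apply (n : ℕ) (x : A) : frobeniusComp p f n x = f x ^ p ^ n := by
  simp [frobeniusComp, iterateFrobenius_def]

theorem frobeniusComp_eq (n : ℕ) : frobeniusComp p f n = (iterateFrobenius B p n).comp f := by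
  ext x
  simp [frobeniusComp, iterateFrobenius_def]

/-- The elements of `A` that are null-homotopic on `G`. -/
def nullHomotopicElements (G : ChainComplex (ModuleCat.{u} A) ℕ) : Set A :=
  {x | Nonempty (Homotopy (x • 𝟙 G) 0)}

variable {G : ChainComplex (ModuleCat.{u} A) ℕ} (hbdd : IsBoundedComplex G)
  (hfree : IsFreeComplex G) (hfin : HasFiniteLengthHomology A G)
include hbdd hfree hfin

/-- An element killing all homology has a null-homotopic power, so P contains the intersection of
finitely many annihilators, hence one of them. It thus lies in the support of a module of finite
length. -/
theorem isMaximal_of_nullHomotopicElements_subset (P : Ideal A) [hP : P.IsPrime]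
    (h : nullHomotopicElements G ⊆ P) :
    P.IsMaximal ∧ ∃ i, (⟨P, hP⟩ : PrimeSpectrum A) ∈ Module.support A (G.homology i) := by
  have hproj : ∀ i, Projective (G.X i) := fun i => by
    have := hfree i
    exact (IsProjective.iff_projective (G.X i)).1 inferInstance
  obtain ⟨s, hs⟩ := id hbdd
  have hz : ∀ i, s < i → Subsingleton (G.homology i) := fun i hi => by
    have := hs i hi
    exact ModuleCat.subsingleton_of_isZero (HomologicalComplex.ExactAt.of_isZero
      (ModuleCat.isZero_of_subsingleton (G.X i))).isZero_homology
  have h1 : (Finset.range (s + 1)).inf (fun i => Module.annihilator A (G.homology i)) ≤ P := by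
    intro x hx
    rw [Submodule.mem_finsetInf] at hx
    obtain ⟨m, hm⟩ := exists_homotopy_pow_smul_id G hbdd hproj x fun i => by
      ext y
      by_cases hi : i < s + 1
      · exact Module.mem_annihilator.1 (hx i (Finset.mem_range.2 hi)) y
      · have := hz i (by omega)
        exact Subsingleton.elim _ _
    exact hP.mem_of_pow_mem m (h hm)
  obtain ⟨i, hi, hle⟩ := (Ideal.IsPrime.inf_le' hP).1 h1
  have hfi := hfin i
  have hfi' : IsFiniteLength A (G.homology i) := hfi
  have : Module.Finite A (G.homology i) := by
    have := (isFiniteLength_iff_isNoetherian_isArtinian.1 hfi').1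
    infer_instance
  have hsupp : (⟨P, hP⟩ : PrimeSpectrum A) ∈ Module.support A (G.homology i) :=
    Module.mem_support_iff_of_finite.2 hle
  exact ⟨isMaximal_of_mem_support_of_isFiniteLength hfi' _ hsupp, i, hsupp⟩

-- Both sides are dimensions of the homology of G over a residue field, and the field extension A/m
-- → B/P preserves them. The homomorphism enters only through its contraction of P, which makes the
-- bound uniform in the Frobenius twist.
omit hbdd in
theorem homologyLength_quotient_maximal [IsNoetherianRing A] (φ : A →+* B) (P : Ideal B)
    [P.IsMaximal] (m : Ideal A) [m.IsMaximal] (hm : P.comap φ = m) (i : ℕ) :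
    homologyLength φ (ModuleCat.of B (B ⧸ P)) G i =
      homologyLength (RingHom.id A) (ModuleCat.of A (A ⧸ m)) G i := by
  let _ := Ideal.Quotient.field P
  let _ := Ideal.Quotient.field m
  let ψ : A ⧸ m →+* B ⧸ P := Ideal.quotientMap P φ hm.ge
  have hψ : ψ.comp (Ideal.Quotient.mk m) = (Ideal.Quotient.mk P).comp φ := by
    ext x; rfl
  have e1 : homologyLength φ (ModuleCat.of B (B ⧸ P)) G i = Module.length (B ⧸ P)
      ((baseChange ((Ideal.Quotient.mk P).comp φ) G).homology i) := by
    have h1 := length_homology_restrictScalars (Ideal.Quotient.mk P)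
      (baseChange ((Ideal.Quotient.mk P).comp φ) G) i
    rw [length_restrictScalars_of_surjective _ Ideal.Quotient.mk_surjective] at h1
    exact h1
  have e2 : homologyLength (RingHom.id A) (ModuleCat.of A (A ⧸ m)) G i = Module.length (A ⧸ m)
      ((baseChange (Ideal.Quotient.mk m) G).homology i) := by
    have h1 := length_homology_restrictScalars (Ideal.Quotient.mk m)
      (baseChange (Ideal.Quotient.mk m) G) i
    rw [length_restrictScalars_of_surjective _ Ideal.Quotient.mk_surjective] at h1
    exact h1
  have hG : ∀ i, Module.Flat A (G.X i) := fun i => by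
    have := hfree i
    infer_instance
  have hfl : IsFiniteLength (A ⧸ m) ((baseChange (Ideal.Quotient.mk m) G).homology i) := by
    rw [← Module.length_ne_top_iff, ← e2]
    exact homologyLength_ne_top_of_finite G hG
      (fun i => Module.length_ne_top_iff.2 (hfin i)) i (A ⧸ m)
  have hflat : ψ.Flat := by
    let _ := ψ.toAlgebra
    exact (RingHom.flat_algebraMap_iff (R := A ⧸ m) (S := B ⧸ P)).2 inferInstance
  rw [e1, e2, ← hψ, length_homology_eq_of_iso (baseChangeComp (Ideal.Quotient.mk m) ψ G) i,
    length_homology_baseChange_of_flat ψ hflat]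
  have h3 := sum_length_extendScalars (ι := Unit) (T := fun _ => B ⧸ P) (fun _ => ψ)
    (fun _ => hflat) hfl (fun n hn _ => by
      have hn0 : n = ⊥ := (Ideal.eq_bot_or_top n).resolve_right hn.ne_top
      subst hn0
      rw [Finset.univ_unique, Finset.sum_singleton]
      have e3 : ModuleCat.of (A ⧸ m) ((A ⧸ m) ⧸ (⊥ : Ideal (A ⧸ m))) ≅
          ModuleCat.of (A ⧸ m) (A ⧸ m) :=
        (Submodule.quotEquivOfEqBot ⊥ rfl).toModuleIso
      rw [((ModuleCat.extendScalars.{u, u, u} ψ).mapIso e3).toLinearEquiv.length_eq]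
      let _ := ψ.toAlgebra
      have e4 : ((ModuleCat.extendScalars.{u, u, u} ψ).obj (ModuleCat.of (A ⧸ m) (A ⧸ m))) ≃ₗ[B ⧸ P]
          (B ⧸ P) := TensorProduct.AlgebraTensorModule.rid (A ⧸ m) (B ⧸ P) (B ⧸ P)
      rw [e4.length_eq, Module.length_eq_one])
  rw [Finset.univ_unique, Finset.sum_singleton] at h3
  exact h3

-- The contraction of a prime along f is unchanged by composing with a power of Frobenius. At a
-- prime containing the annihilating elements the homology is therefore that of one residue field of
-- A, for all n; `hf` makes such a prime maximal.
omit [CharP B p] in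
theorem powerAnnihilatedFamily [IsNoetherianRing A]
    (hf : ∀ P : Ideal B, P.IsPrime → (∀ h : (P.comap f).IsPrime, (P.comap f).IsMaximal →
      (∃ i, (⟨P.comap f, h⟩ : PrimeSpectrum A) ∈ Module.support A (G.homology i)) →
        P.IsMaximal)) :
    PowerAnnihilatedFamily (frobeniusComp p f) (fun n => p ^ n) (f '' nullHomotopicElements G) G where
  flat i := by
    have := hfree i
    infer_instance
  one_le n := Nat.one_le_pow _ _ (Fact.out : p.Prime).pos
  pow_smul := by
    rintro _ ⟨x, ⟨hx⟩, rfl⟩ n M i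
    rw [← frobeniusComp_apply]
    exact smul_homology_tensorComplex_eq_zero _ M G x hx i
  bounded P hP hX := by
    obtain ⟨s, hs⟩ := id hbdd
    have hsub : nullHomotopicElements G ⊆ P.comap f := fun x hx => hX ⟨x, hx, rfl⟩
    obtain ⟨hmax, hsupp⟩ := isMaximal_of_nullHomotopicElements_subset hbdd hfree hfin _ hsub
    have hPmax := hf P hP inferInstance hmax hsupp
    have hG : ∀ i, Module.Flat A (G.X i) := fun i => by
      have := hfree i
      infer_instance
    refine ⟨∑ i ∈ Finset.range (s + 1), (homologyLength (RingHom.id A) (ModuleCat.of A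
      (A ⧸ P.comap f)) G i).toNat, fun n i => ?_⟩
    by_cases hi : i < s + 1
    · have hc : P.comap (frobeniusComp p f n) = P.comap f := by
        ext x
        rw [Ideal.mem_comap, Ideal.mem_comap, frobeniusComp_apply]
        exact hP.pow_mem_iff_mem _ (pow_pos (Fact.out : p.Prime).pos n)
      rw [homologyLength_quotient_maximal hfree hfin _ P _ hc,
        ← ENat.natCast_toNat (homologyLength_ne_top_of_finite G hG
          (fun i => Module.length_ne_top_iff.2 (hfin i)) i (A ⧸ P.comap f))]
      exact_mod_cast Finset.single_le_sum (f := fun i => (homologyLength (RingHom.id A)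
        (ModuleCat.of A (A ⧸ P.comap f)) G i).toNat) (fun _ _ => Nat.zero_le _)
        (Finset.mem_range.2 hi)
    · have := hs i (by omega)
      rw [homologyLength_eq_zero_of_subsingleton]
      exact zero_le

end Frobenius

/-! ### Krull dimension -/

section Dimension

/-- Incomparability makes contraction of primes strictly monotone; lying over and going up lift
chains. -/
theorem ringKrullDim_eq_of_isIntegral (R S : Type*) [CommRing R] [CommRing S] [Algebra R S]
    [FaithfulSMul R S] [Algebra.IsIntegral R S] : ringKrullDim S = ringKrullDim R := by
  refine le_antisymm ?_ ?_
  · refine Order.krullDim_le_of_strictMono (PrimeSpectrum.comap (algebraMap R S)) fun P Q h => ?_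
    exact Ideal.IsIntegral.comap_lt_comap (R := R) (I := P.asIdeal) (J := Q.asIdeal) h
  · refine iSup_le fun l => ?_
    obtain ⟨P, -, hP, hPl⟩ := Ideal.exists_ideal_over_prime_of_isIntegral (S := S) l.head.asIdeal ⊥
      (by
        rw [← RingHom.ker_eq_comap_bot, (RingHom.injective_iff_ker_eq_bot _).1
          (FaithfulSMul.algebraMap_injective R S)]
        exact bot_le)
    have : P.LiesOver l.head.asIdeal := ⟨hPl.symm⟩
    obtain ⟨L, hL, -, -⟩ := Ideal.exists_ltSeries_of_hasGoingUp (S := S) l P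
    rw [← hL]
    exact Order.LTSeries.length_le_krullDim L

theorem krullDimNat_eq_of_isIntegral (R S : Type*) [CommRing R] [CommRing S] [Algebra R S]
    [FaithfulSMul R S] [Algebra.IsIntegral R S] : krullDimNat S = krullDimNat R := by
  rw [krullDimNat, krullDimNat, ringKrullDim_eq_of_isIntegral R S]

theorem ringKrullDim_eq_krullDimNat (R : Type*) [CommRing R] [FiniteRingKrullDim R] :
    ringKrullDim R = ((krullDimNat R : ℕ∞) : WithBot ℕ∞) := by
  have hb : ringKrullDim R ≠ ⊥ := ringKrullDim_ne_bot
  have ht : ringKrullDim R ≠ ⊤ := ringKrullDim_ne_top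
  unfold krullDimNat
  generalize ringKrullDim R = x at hb ht
  induction x with
  | bot => exact absurd rfl hb
  | coe y =>
    have : y ≠ ⊤ := fun h => ht (by rw [h]; rfl)
    rw [WithBot.unbotD_coe, ENat.natCast_toNat this]

theorem coheight_lt_krullDimNat_add_one {R : Type*} [CommRing R] [FiniteRingKrullDim R]
    (P : PrimeSpectrum R) : Order.coheight P < (krullDimNat R : ℕ∞) + 1 := by
  have h2 := Order.coheight_le_krullDim P
  change _ ≤ ringKrullDim R at h2
  rw [ringKrullDim_eq_krullDimNat, WithBot.coe_le_coe] at h2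
  exact ENat.lt_add_one_iff (ENat.natCast_ne_top _) |>.2 h2

end Dimension

/-! ### Comparison of the Frobenius functors of R and S -/

section FrobeniusEuler

variable {A B : Type u} [CommRing A] [CommRing B] (p : ℕ) [Fact p.Prime] [CharP A p] [CharP B p]

/-- Iterated Frobenius functors of a base change. -/
def frobeniusFunctorIterBaseChangeIso (f : A →+* B) (G : ChainComplex (ModuleCat.{u} A) ℕ) (n : ℕ) :
    (frobeniusFunctor p B)^[n] (baseChange f G) ≅
      tensorComplex (frobeniusComp p f n) (ModuleCat.of B B) G :=
  frobeniusFunctorIterIso p B n _ ≪≫ (baseChangeComp f (iterateFrobenius B p n) G).symm ≪≫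
    eqToIso (by rw [frobeniusComp_eq]; rfl)

/-- Iterated Frobenius functors as tensor products. -/
def frobeniusFunctorIterTensorIso (G : ChainComplex (ModuleCat.{u} A) ℕ) (n : ℕ) :
    (frobeniusFunctor p A)^[n] G ≅
      tensorComplex (frobeniusComp p (RingHom.id A) n) (ModuleCat.of A A) G :=
  frobeniusFunctorIterIso p A n G

theorem length_homologyOver_eq_of_iso [Algebra A B] {C D : ChainComplex (ModuleCat.{u} B) ℕ}
    (e : C ≅ D) (i : ℕ) : Module.length A (homologyOver A C i) =
      Module.length A (homologyOver A D i) :=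
  (((ModuleCat.restrictScalars (algebraMap A B)).mapIso
    (HomologicalComplex.homologyMapIso e i)).toLinearEquiv).length_eq

/-- Frobenius commutes with A → B, so the Frobenius pull-back over B is the one over A tensored with
B. Only the A-module structure of B matters after this. -/
theorem length_homologyOver_frobenius_baseChange [Algebra A B] (G : ChainComplex (ModuleCat.{u} A) ℕ)
    (n i : ℕ) : Module.length A (homologyOver A
      ((frobeniusFunctor p B)^[n] (baseChange (algebraMap A B) G)) i) =
      homologyLength (frobeniusComp p (RingHom.id A) n) (ModuleCat.of A B) G i := by
  rw [length_homologyOver_eq_of_iso (frobeniusFunctorIterBaseChangeIso p (algebraMap A B) G n)]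
  let e : (ModuleCat.restrictScalars (algebraMap A B)).obj (ModuleCat.of B B) ≃ₗ[A]
      ModuleCat.of A B :=
    { AddEquiv.refl B with
      map_smul' := fun a b => (Algebra.smul_def (R := A) (A := B) a b).symm }
  rw [← homologyLength_congr (frobeniusComp p (RingHom.id A) n) G e.toModuleIso]
  exact (length_homology_restrictScalars (algebraMap A B) (tensorComplex
    (frobeniusComp p (algebraMap A B) n) (ModuleCat.of B B) G) i).symm

theorem eulerChar_frobenius_baseChange [Algebra A B] (G : ChainComplex (ModuleCat.{u} A) ℕ)
    (n : ℕ) : eulerChar A ((frobeniusFunctor p B)^[n] (baseChange (algebraMap A B) G)) =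
      tensorChi (frobeniusComp p (RingHom.id A) n) G B :=
  finsum_congr fun i => by
    rw [length_homologyOver_frobenius_baseChange]
    rfl

theorem eulerChar_frobenius (G : ChainComplex (ModuleCat.{u} A) ℕ) (n : ℕ) :
    eulerChar A ((frobeniusFunctor p A)^[n] G) =
      tensorChi (frobeniusComp p (RingHom.id A) n) G A :=
  eulerChar_eq_of_iso (frobeniusFunctorIterTensorIso p G n)

end FrobeniusEuler

section Limit

theorem tendsto_div_of_abs_sub_le {a b : ℕ → ℤ} {r : ℕ} {p d c : ℕ} (hp : 1 < p) {L : ℝ}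
    (h : ∀ n, |b n - r * a n| * p ^ n ≤ (c * (p ^ n) ^ d : ℤ))
    (ha : Filter.Tendsto (fun n => (a n : ℝ) / (p : ℝ) ^ (n * d)) Filter.atTop (nhds L)) :
    Filter.Tendsto (fun n => (b n : ℝ) / (p : ℝ) ^ (n * d)) Filter.atTop (nhds (r * L)) := by
  have hp0 : (0 : ℝ) < p := by positivity
  have h1 : Filter.Tendsto (fun n : ℕ => (c : ℝ) * ((p : ℝ)⁻¹) ^ n) Filter.atTop (nhds 0) := by
    have := (tendsto_pow_atTop_nhds_zero_of_lt_one (r := (p : ℝ)⁻¹) (by positivity)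
      (inv_lt_one_of_one_lt₀ (by exact_mod_cast hp))).const_mul (c : ℝ)
    simpa using this
  have h2 : Filter.Tendsto (fun n => (b n : ℝ) / (p : ℝ) ^ (n * d) -
      r * ((a n : ℝ) / (p : ℝ) ^ (n * d))) Filter.atTop (nhds 0) := by
    refine squeeze_zero_norm (fun n => ?_) h1
    have h3 : |(b n : ℝ) - r * a n| * (p : ℝ) ^ n ≤ c * ((p : ℝ) ^ n) ^ d := by
      exact_mod_cast h n
    have h4 : (b n : ℝ) / (p : ℝ) ^ (n * d) - r * ((a n : ℝ) / (p : ℝ) ^ (n * d)) =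
        ((b n : ℝ) - r * a n) / (p : ℝ) ^ (n * d) := by ring
    rw [h4, Real.norm_eq_abs, abs_div, abs_of_pos (by positivity : (0 : ℝ) < (p : ℝ) ^ (n * d)),
      div_le_iff₀ (by positivity), pow_mul, inv_pow, mul_assoc, mul_comm _ ((( p : ℝ) ^ n) ^ d),
      ← mul_assoc, ← div_eq_mul_inv, le_div_iff₀ (by positivity)]
    exact h3
  have h5 := h2.add (ha.const_mul (r : ℝ))
  simpa using h5

end Limit

/-! ### The rank formula, given the limit over R -/

section Main

/-- The rank comparison is applied over the domain R to the module S; dividing by the p^(n dim R)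
leaves an error of order p^(-n). The normalisations agree because S is integral over R. -/
theorem isLimitMultiplicity_baseChange (p : ℕ) [Fact p.Prime]
    (R S : Type u) [CommRing R] [IsDomain R] [IsNoetherianRing R] [FiniteRingKrullDim R]
    [CharP R p] [CommRing S] [CharP S p] [Algebra R S] [FaithfulSMul R S] [Module.Finite R S]
    (G : ChainComplex (ModuleCat.{u} R) ℕ) (hbdd : IsBoundedComplex G) (hfree : IsFreeComplex G)
    (hfin : HasFiniteLengthHomology R G) {L : ℝ} (hL : IsLimitMultiplicity p R G L) :
    IsLimitMultiplicity p R (baseChange (algebraMap R S) G) (Module.finrank R S * L) := by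
  have F := powerAnnihilatedFamily p (RingHom.id R) hbdd hfree hfin fun P _ h => fun _ _ => by
    rwa [Ideal.comap_id] at *
  refine ⟨fun n i => ?_, ?_⟩
  · rw [← Module.length_ne_top_iff, length_homologyOver_frobenius_baseChange]
    exact F.homologyLength_ne_top (d := krullDimNat R + 1)
      (fun P => by exact_mod_cast coheight_lt_krullDimNat_add_one P) S n i
  · obtain ⟨c, hc⟩ := F.exists_abs_tensorChi_sub_le hbdd coheight_lt_krullDimNat_add_one R S
      Function.surjective_id
    rw [krullDimNat_eq_of_isIntegral R S]
    simp only [eulerChar_frobenius_baseChange]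
    refine tendsto_div_of_abs_sub_le (Fact.out : p.Prime).one_lt (c := c) (fun n => ?_)
      (a := fun n => tensorChi (frobeniusComp p (RingHom.id R) n) G R) ?_
    · exact_mod_cast hc n
    · simpa only [eulerChar_frobenius] using hL.2

/-- Simple S-modules stay simple over R, so lengths over R and S agree on S-modules of finite
length. -/
theorem IsLimitMultiplicity.of_surjective (p : ℕ) [Fact p.Prime]
    (R S : Type u) [CommRing R] [CommRing S] [CharP S p] [Algebra R S]
    (h : ∀ n : Ideal S, n.IsMaximal → Function.Surjective (algebraMap R (S ⧸ n)))
    (C : ChainComplex (ModuleCat.{u} S) ℕ) {L : ℝ} (hL : IsLimitMultiplicity p R C L) :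
    IsLimitMultiplicity p S C L := by
  have h1 : ∀ D : ChainComplex (ModuleCat.{u} S) ℕ, HasFiniteLengthHomology R D →
      HasFiniteLengthHomology S D := fun D hD i => by
    let _ : Module R (D.homology i) := Module.compHom _ (algebraMap R S)
    have : IsScalarTower R S (D.homology i) := ⟨fun a b x => by
      rw [Algebra.smul_def, mul_smul]; rfl⟩
    have h2 : IsFiniteLength R (D.homology i) := hD i
    change IsFiniteLength S (D.homology i)
    rw [isFiniteLength_iff_isNoetherian_isArtinian] at h2 ⊢
    obtain ⟨_, _⟩ := h2
    exact ⟨isNoetherian_of_tower R inferInstance, isArtinian_of_tower R inferInstance⟩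
  have h3 : ∀ (D : ChainComplex (ModuleCat.{u} S) ℕ) i, IsFiniteLength S (D.homology i) →
      Module.length R (homologyOver R D i) = Module.length S (D.homology i) := fun D i hD => by
    refine length_restrictScalars_eq (algebraMap R S) (fun m hm => ?_) hD
    let _ := Ideal.Quotient.field m
    have h4 := length_restrictScalars_of_surjective (algebraMap R (S ⧸ m)) (h m hm)
      (ModuleCat.of (S ⧸ m) (S ⧸ m))
    rw [Module.length_eq_one (S ⧸ m) (S ⧸ m)] at h4
    exact h4
  refine ⟨fun n => h1 _ (hL.1 n), ?_⟩
  convert hL.2 using 5 with n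
  refine finsum_congr fun i => ?_
  rw [h3 _ _ (h1 _ (hL.1 n) i)]
  rfl

end Main

/-! ### Formal smoothness over perfect fields -/

open MvPolynomial in
/-- A field extension is formally smooth if all its finitely generated subextensions are. -/
theorem Algebra.FormallySmooth.of_forall_fg (F : Type v) (K : Type u) [Field F] [Field K] [Algebra F K]
    (h : ∀ L : IntermediateField F K, L.FG → Algebra.FormallySmooth F L) :
    Algebra.FormallySmooth F K := by
  refine ⟨inferInstance, ⟨fun a b => ?_⟩⟩
  -- A class here is represented by a polynomial vanishing at the tautological point together with
  -- all its partial derivatives. It involves finitely many variables, so it comes from a finitely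
  -- generated subextension, where it lies in the square of the ideal.
  suffices H : ∀ a : Algebra.H1Cotangent F K, a = 0 by rw [H a, H b]
  rintro ⟨a, ha⟩
  obtain ⟨⟨x, hx⟩, rfl⟩ := Algebra.Extension.Cotangent.mk_surjective a
  let x' : MvPolynomial K F := x
  have h1 : ∀ i : K, aeval (_root_.id : K → K) (pderiv i x') = 0 := fun i => by
    have := congrArg (fun t => (Algebra.Generators.self F K).cotangentSpaceBasis.repr t i) ha
    simp [Algebra.Generators.cotangentSpaceBasis_repr_one_tmul] at this
    exact this
  have hx0 : aeval (_root_.id : K → K) x' = 0 := by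
    have : algebraMap _ K x = 0 := hx
    exact this
  let L := IntermediateField.adjoin F (x'.vars : Set K)
  have hL : L.FG := ⟨x'.vars, rfl⟩
  have := h L hL
  have hv : (x'.vars : Set K) ⊆ Set.range ((↑) : L → K) := by
    rw [Subtype.range_coe]
    exact IntermediateField.subset_adjoin F _
  obtain ⟨y, hy⟩ := exists_rename_eq_of_vars_subset_range x' ((↑) : L → K)
    Subtype.val_injective hv
  have hc : ∀ z : MvPolynomial L F, ((aeval (_root_.id : L → L) z : L) : K) =
      aeval (_root_.id : K → K) (rename ((↑) : L → K) z) := fun z => by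
    rw [aeval_rename, ← IntermediateField.coe_val, ← AlgHom.comp_apply, comp_aeval]
    rfl
  have hy0 : y ∈ (Algebra.Generators.self F L).toExtension.ker := by
    have : aeval (_root_.id : L → L) y = 0 := by
      apply Subtype.val_injective
      rw [hc, hy, hx0]
      rfl
    exact this
  have hyc : (Algebra.Generators.self F L).toExtension.cotangentComplex
      (Algebra.Extension.Cotangent.mk ⟨y, hy0⟩) = 0 := by
    apply (Algebra.Generators.self F L).cotangentSpaceBasis.repr.injective
    refine Finsupp.ext fun i => ?_
    rw [Algebra.Extension.cotangentComplex_mk,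
      Algebra.Generators.cotangentSpaceBasis_repr_one_tmul]
    have : aeval (_root_.id : L → L) (pderiv i y) = 0 := by
      apply Subtype.val_injective
      rw [hc, ← pderiv_rename Subtype.val_injective, hy, h1]
      rfl
    exact this.trans (DFunLike.congr_fun
      (map_zero (Algebra.Generators.self F L).cotangentSpaceBasis.repr) i).symm
  have hy2 : y ∈ (Algebra.Generators.self F L).toExtension.ker ^ 2 := by
    let z : Algebra.H1Cotangent F L := ⟨_, hyc⟩
    have h2 : z = 0 := Subsingleton.elim _ _
    have h3 := congrArg Subtype.val h2
    have h4 : Ideal.toCotangent _ (⟨y, hy0⟩ : (Algebra.Generators.self F L).toExtension.ker) = 0 :=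
      h3
    exact (Ideal.toCotangent_eq_zero _ _).1 h4
  have hx2 : x' ∈ (Algebra.Generators.self F K).toExtension.ker ^ 2 := by
    let I₁ : Ideal (MvPolynomial L F) := (Algebra.Generators.self F L).toExtension.ker
    let I₂ : Ideal (MvPolynomial K F) := (Algebra.Generators.self F K).toExtension.ker
    let ρ : MvPolynomial L F →+* MvPolynomial K F := (rename ((↑) : L → K)).toRingHom
    have h5 : I₁.map ρ ≤ I₂ := by
      rw [Ideal.map_le_iff_le_comap]
      intro z hz
      have h6 : aeval (_root_.id : L → L) z = 0 := hz
      have h7 : aeval (_root_.id : K → K) (rename ((↑) : L → K) z) = 0 := by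
        rw [← hc, h6]; rfl
      exact h7
    have h9 : ρ y ∈ I₂ ^ 2 := by
      refine Ideal.pow_right_mono h5 2 ?_
      rw [← Ideal.map_pow]
      exact Ideal.mem_map_of_mem ρ hy2
    rw [← hy]
    exact h9
  apply Subtype.ext
  have h8 : Ideal.toCotangent _ (⟨x, hx⟩ : (Algebra.Generators.self F K).toExtension.ker) = 0 :=
    (Ideal.toCotangent_eq_zero _ _).2 hx2
  exact h8

/-- Every field extension of a perfect field is formally smooth. -/
theorem Algebra.FormallySmooth.of_perfect (F : Type v) (K : Type u) [Field F] [PerfectField F] [Field K]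
    [Algebra F K] : Algebra.FormallySmooth F K :=
  Algebra.FormallySmooth.of_forall_fg F K fun L hL => by
    have : Algebra.EssFiniteType F L := IntermediateField.essFiniteType_iff.2 hL
    infer_instance

/-! ### Flatness by adic approximation -/

section Flatness

theorem mem_smul_top_of_forall_mem {R : Type*} [CommRing R] {l : ℕ} (I : Ideal R) {v : Fin l → R}
    (hv : ∀ i, v i ∈ I) : v ∈ I • (⊤ : Submodule R (Fin l → R)) := by
  have h : v = ∑ i, v i • (Pi.single i 1 : Fin l → R) := by
    simpa using (Finset.univ_sum_single v).symm.trans (by simp [← Pi.single_smul])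
  rw [h]
  exact Submodule.sum_mem _ fun i _ => Submodule.smul_mem_smul (hv i) trivial

theorem forall_mem_of_mem_smul_top {R : Type*} [CommRing R] {l : ℕ} (I : Ideal R) {v : Fin l → R}
    (hv : v ∈ I • (⊤ : Submodule R (Fin l → R))) (i : Fin l) : v i ∈ I := by
  induction hv using Submodule.smul_induction_on' with
  | smul r hr x _ => exact I.mul_mem_right _ hr
  | add x _ y _ hx hy => exact I.add_mem hx hy

/-- A Noetherian local algebra `T` over a Noetherian ring `R` is flat if it is approximated
`J`-adically by a flat `R`-algebra. -/
theorem flat_of_adic_approximation (R B T : Type*) [CommRing R] [CommRing B] [CommRing T]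
    [IsNoetherianRing R] [IsNoetherianRing T] [IsLocalRing T] [Algebra R B] [Algebra B T]
    [Algebra R T] [IsScalarTower R B T] [Module.Flat R B] (J : Ideal R)
    (hJ : J.map (algebraMap R T) ≠ ⊤)
    (h1 : ∀ n (t : T), ∃ b : B, t - algebraMap B T b ∈ (J ^ n).map (algebraMap R T))
    (h2 : ∀ n (b : B), algebraMap B T b ∈ (J ^ n).map (algebraMap R T) →
      b ∈ (J ^ n).map (algebraMap R B)) : Module.Flat R T := by
  refine Module.Flat.of_forall_isTrivialRelation fun {l f x} hfx => ?_
  let Φ : (Fin l → R) →ₗ[R] R := Fintype.linearCombination R f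
  have hΦ : ∀ a, Φ a = ∑ i, f i * a i := fun a => by
    simp [Φ, Fintype.linearCombination_apply, mul_comm]
  let ι : (Fin l → R) → (Fin l → T) := fun a i => algebraMap R T (a i)
  -- By the equational criterion, x must be a T-combination of solutions over R. Krull's
  -- intersection theorem for the quotient by `NT` reduces this to solving modulo each power of J.
  let NT : Submodule T (Fin l → T) := Submodule.span T (ι '' (LinearMap.ker Φ))
  suffices hx : x ∈ NT by
    obtain ⟨k, c, g, hg⟩ := Submodule.mem_span_set'.1 hx
    have hg' : ∀ j, ∃ a, Φ a = 0 ∧ ι a = g j := fun j => (g j).2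
    choose a ha hag using hg'
    refine ⟨k, fun i j => a j i, c, fun i => ?_, fun j => ?_⟩
    · rw [← hg, Finset.sum_apply]
      refine Finset.sum_congr rfl fun j _ => ?_
      rw [← hag, Pi.smul_apply, smul_eq_mul, mul_comm]
      exact (Algebra.smul_def (a j i) (c j)).symm
    · rw [← hΦ, ha]
  -- Artin–Rees: a vector whose image under `Φ` is in J^(n+k) differs from a true solution by a
  -- vector with entries in J^n.
  obtain ⟨k, hk⟩ := Ideal.exists_pow_inf_eq_pow_smul J (LinearMap.range Φ)
  have hAR : ∀ n (a : Fin l → R), Φ a ∈ J ^ (n + k) → ∃ z : Fin l → R, (∀ i, z i ∈ J ^ n) ∧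
      Φ z = Φ a := fun n a ha => by
    have h3 : Φ a ∈ J ^ (n + k) • ⊤ ⊓ LinearMap.range Φ :=
      ⟨by simpa using ha, LinearMap.mem_range_self Φ a⟩
    rw [hk (n + k) (by omega), Nat.add_sub_cancel] at h3
    have h4 : Φ a ∈ J ^ n • LinearMap.range Φ := Submodule.smul_mono le_rfl inf_le_right h3
    rw [LinearMap.range_eq_map, ← Submodule.map_smul''] at h4
    obtain ⟨z, hz, hza⟩ := h4
    exact ⟨z, forall_mem_of_mem_smul_top _ hz, hza⟩
  have key : ∀ n : ℕ, ∃ w ∈ NT, x - w ∈ (J ^ n).map (algebraMap R T) •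
      (⊤ : Submodule T (Fin l → T)) := fun n => by
    choose b hb using fun i => h1 (n + k) (x i)
    have h5 : ∑ i, algebraMap R B (f i) * b i ∈ (J ^ (n + k)).map (algebraMap R B) := by
      apply h2
      have h6 : algebraMap B T (∑ i, algebraMap R B (f i) * b i) =
          -∑ i, algebraMap R T (f i) * (x i - algebraMap B T (b i)) := by
        have h7 : ∑ i, algebraMap R T (f i) * x i = 0 := by
          simpa [Algebra.smul_def] using hfx
        simp [mul_sub, h7, ← IsScalarTower.algebraMap_apply R B T]
      rw [h6]
      exact neg_mem (Ideal.sum_mem _ fun i _ => Ideal.mul_mem_left _ _ (hb i))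
    obtain ⟨m, c, g, hg⟩ := Submodule.mem_span_set'.1 h5
    have hg' : ∀ j, ∃ a ∈ J ^ (n + k), algebraMap R B a = g j := fun j => (g j).2
    choose g' hg'J hg'g using hg'
    -- The approximate solution in B becomes an exact relation once elements of J^(n+k) are added as
    -- coefficients, and flatness of B trivialises it over R.
    have h8 : ∑ s : Fin l ⊕ Fin m, (Sum.elim f (fun j => - g' j) s) • (Sum.elim b c s) = 0 := by
      rw [Fintype.sum_sum_type]
      simp only [Sum.elim_inl, Sum.elim_inr, Algebra.smul_def, map_neg, neg_mul,
        Finset.sum_neg_distrib, ← hg, hg'g]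
      simp [mul_comm]
    obtain ⟨κ, a, y, hay, ha⟩ := Module.Flat.isTrivialRelation_of_sum_smul_eq_zero (R := R) (M := B) h8
    have h9 : ∀ j, Φ (fun i => a (Sum.inl i) j) ∈ J ^ (n + k) := fun j => by
      have h10 := ha j
      rw [Fintype.sum_sum_type] at h10
      simp only [Sum.elim_inl, Sum.elim_inr, neg_mul, Finset.sum_neg_distrib] at h10
      rw [hΦ, eq_of_sub_eq_zero ((sub_eq_add_neg _ _).trans h10)]
      exact Ideal.sum_mem _ fun i _ => Ideal.mul_mem_right _ _ (hg'J i)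
    choose z hzJ hz using fun j => hAR n _ (h9 j)
    refine ⟨∑ j, algebraMap B T (y j) • ι ((fun i => a (Sum.inl i) j) - z j), ?_, ?_⟩
    · refine Submodule.sum_mem _ fun j _ => Submodule.smul_mem _ _ (Submodule.subset_span ⟨_, ?_, rfl⟩)
      rw [SetLike.mem_coe, LinearMap.mem_ker, map_sub, hz, sub_self]
    · refine mem_smul_top_of_forall_mem _ fun i => ?_
      have h11 : algebraMap B T (b i) = ∑ j, algebraMap B T (y j) * algebraMap R T (a (Sum.inl i) j) := by
        have := hay (Sum.inl i)
        simp only [Sum.elim_inl] at this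
        rw [this, map_sum]
        refine Finset.sum_congr rfl fun j _ => ?_
        rw [Algebra.smul_def, map_mul, ← IsScalarTower.algebraMap_apply, mul_comm]
      have h12 : (x - ∑ j, algebraMap B T (y j) • ι ((fun i => a (Sum.inl i) j) - z j)) i =
          (x i - algebraMap B T (b i)) + ∑ j, algebraMap B T (y j) * algebraMap R T (z j i) := by
        rw [h11]
        simp only [Pi.sub_apply, Finset.sum_apply, Pi.smul_apply, smul_eq_mul, ι, map_sub, mul_sub,
          Finset.sum_sub_distrib]
        ring
      rw [h12]
      refine add_mem (Ideal.map_mono (Ideal.pow_le_pow_right (by omega)) (hb i))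
        (Ideal.sum_mem _ fun j _ => Ideal.mul_mem_left _ _ (Ideal.mem_map_of_mem _ (hzJ j i)))
  have hbot := Ideal.iInf_pow_smul_eq_bot_of_isLocalRing (M := (Fin l → T) ⧸ NT) _ hJ
  rw [← Submodule.Quotient.mk_eq_zero, ← Submodule.mem_bot T, ← hbot, Submodule.mem_iInf]
  intro n
  obtain ⟨w, hw, hxw⟩ := key n
  have h13 : (Submodule.Quotient.mk x : (Fin l → T) ⧸ NT) = NT.mkQ (x - w) := by
    rw [map_sub, (Submodule.Quotient.mk_eq_zero NT).2 hw |> fun h => (show NT.mkQ w = 0 from h),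
      sub_zero]
    rfl
  rw [h13, ← Ideal.map_pow]
  have h14 := Submodule.mem_map_of_mem (f := NT.mkQ) hxw
  rw [Submodule.map_smul''] at h14
  exact Submodule.smul_mono le_rfl le_top h14

end Flatness

/-! ### Noetherianity and F-finiteness of complete rings -/

section CompleteNoetherian

variable {T : Type*} [CommRing T] {m : Ideal T} [IsAdicComplete m T]

/-- In a complete ring, an ideal is generated by elements whose initial forms generate. -/
theorem fg_of_forall_exists_sub_mem {ι : Type*} [Fintype ι] (g : ι → T) (c : ℕ) (I : Ideal T)
    (hg : ∀ i, g i ∈ I)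
    (h : ∀ D, ∀ t ∈ I ⊓ m ^ D, ∃ a : ι → T, (∀ i, a i ∈ m ^ (D - c)) ∧
      t - ∑ i, a i * g i ∈ m ^ (D + 1)) : I.FG := by
  have hstep : ∀ D (t : (I ⊓ m ^ D : Ideal T)), ∃ a : ι → T, (∀ i, a i ∈ m ^ (D - c)) ∧
      (t : T) - ∑ i, a i * g i ∈ I ⊓ m ^ (D + 1) := fun D t => by
    obtain ⟨a, ha, hat⟩ := h D t t.2
    exact ⟨a, ha, sub_mem t.2.1 (Ideal.sum_mem _ fun i _ => I.mul_mem_left _ (hg i)), hat⟩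
  choose A hA hA' using hstep
  suffices I = Ideal.span (Set.range g) by
    rw [this]
    exact Submodule.fg_span (Set.finite_range g)
  refine le_antisymm (fun t ht => ?_) (Ideal.span_le.2 (by rintro _ ⟨i, rfl⟩; exact hg i))
  let r : (D : ℕ) → (I ⊓ m ^ D : Ideal T) := fun D =>
    Nat.rec (motive := fun D => (I ⊓ m ^ D : Ideal T)) ⟨t, ht, by simp⟩
      (fun D s => ⟨(s : T) - ∑ i, A D s i * g i, hA' D s⟩) D
  have hr : ∀ D, (r (D + 1)).1 = (r D).1 - ∑ i, A D (r D) i * g i := fun D => rfl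
  let s : ℕ → ι → T := fun D i => ∑ k ∈ Finset.range D, A k (r k) i
  have hs : ∀ D, t - ∑ i, s D i * g i = (r D).1 := fun D => by
    induction D with
    | zero => simp [s]; rfl
    | succ D ih =>
      rw [hr, ← ih]
      simp only [s, Finset.sum_range_succ, add_mul, Finset.sum_add_distrib]
      ring
  -- The correction at stage k lies only in m^(k - c), so the partial sums are reindexed by c to be
  -- Cauchy at the standard rate.
  have hcauchy : ∀ i {a b : ℕ}, a ≤ b → s (a + c) i ≡ s (b + c) i
      [SMOD (m ^ a • ⊤ : Submodule T T)] := fun i a b hab => by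
    rw [SModEq.comm, SModEq.sub_mem]
    have h1 : s (b + c) i - s (a + c) i = ∑ k ∈ Finset.Ico (a + c) (b + c), A k (r k) i :=
      (Finset.sum_Ico_eq_sub _ (by omega)).symm
    rw [h1, smul_eq_mul, Ideal.mul_top]
    refine Ideal.sum_mem _ fun k hk => Ideal.pow_le_pow_right ?_ (hA k (r k) i)
    have := (Finset.mem_Ico.1 hk).1
    omega
  choose L hL using fun i => IsPrecomplete.prec' (I := m) (fun a => s (a + c) i) (hcauchy i)
  have ht : t - ∑ i, L i * g i = 0 := by
    refine IsHausdorff.haus' (I := m) _ fun N => ?_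
    rw [SModEq.zero, smul_eq_mul, Ideal.mul_top]
    have h2 : t - ∑ i, L i * g i = (r (N + c)).1 + ∑ i, (s (N + c) i - L i) * g i := by
      rw [← hs]
      simp only [sub_mul, Finset.sum_sub_distrib]
      ring
    rw [h2]
    refine add_mem (Ideal.pow_le_pow_right (by omega) (r (N + c)).2.2)
      (Ideal.sum_mem _ fun i _ => Ideal.mul_mem_right _ _ ?_)
    have h3 := hL i N
    rw [SModEq.sub_mem, smul_eq_mul, Ideal.mul_top] at h3
    exact h3
  rw [eq_of_sub_eq_zero ht]
  exact Ideal.sum_mem _ fun i _ => Ideal.mul_mem_left _ _ (Ideal.subset_span ⟨i, rfl⟩)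

open MvPolynomial in
theorem homogeneousComponent_mul_of_isHomogeneous {σ K : Type*} [CommRing K] (P F : MvPolynomial σ K)
    {e : ℕ} (hF : F.IsHomogeneous e) (D : ℕ) :
    homogeneousComponent D (P * F) = if e ≤ D then homogeneousComponent (D - e) P * F else 0 := by
  conv_lhs => rw [← sum_homogeneousComponent P, Finset.sum_mul, map_sum]
  have h1 : ∀ i, homogeneousComponent D (homogeneousComponent i P * F) =
      if i + e = D then homogeneousComponent i P * F else 0 := fun i => by
    rw [homogeneousComponent_of_mem (((homogeneousComponent_isHomogeneous i P).mul hF))]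
    congr 1
    exact propext eq_comm
  simp only [h1]
  split_ifs with h
  · by_cases h2 : D - e < P.totalDegree + 1
    · rw [Finset.sum_eq_single_of_mem (D - e) (Finset.mem_range.2 h2), if_pos (by omega)]
      intro b _ hb
      rw [if_neg (by omega)]
    · rw [Finset.sum_eq_zero, homogeneousComponent_eq_zero _ _ (by omega), zero_mul]
      intro i hi
      rw [if_neg]
      have := Finset.mem_range.1 hi
      omega
  · refine Finset.sum_eq_zero fun i _ => if_neg (by omega)

open MvPolynomial in
/-- A complete ring with a finitely generated ideal of definition `m` and a field of
representatives modulo `m` is Noetherian. -/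
theorem isNoetherianRing_of_isAdicComplete {K σ : Type*} [Field K] [Algebra K T] [Finite σ]
    (x : σ → T) (hx : Ideal.span (Set.range x) = m)
    (hK : ∀ t : T, ∃ c : K, t - algebraMap K T c ∈ m) : IsNoetherianRing T := by
  classical
  have _ := Fintype.ofFinite σ
  have hmem : ∀ i, x i ∈ m := fun i => hx ▸ Ideal.subset_span ⟨i, rfl⟩
  have haeval : ∀ (d : ℕ) (P : MvPolynomial σ K), P.IsHomogeneous d → aeval x P ∈ m ^ d := by
    intro d P hP
    rw [aeval_def, eval₂_eq]
    refine Ideal.sum_mem _ fun α hα => Ideal.mul_mem_left _ _ ?_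
    have h1 : ∑ i ∈ α.support, α i = d := by
      have := hP (mem_support_iff.1 hα)
      rw [← Finsupp.degree_apply, Finsupp.degree_eq_weight_one]
      exact this
    rw [← h1, ← Finset.prod_pow_eq_pow_sum]
    exact Ideal.prod_mem_prod fun i _ => Ideal.pow_mem_pow (hmem i) _
  have happrox : ∀ (d : ℕ), ∀ t ∈ m ^ d, ∃ P : MvPolynomial σ K, P.IsHomogeneous d ∧
      t - aeval x P ∈ m ^ (d + 1) := by
    intro d
    induction d with
    | zero =>
      intro t _
      obtain ⟨c, hc⟩ := hK t
      exact ⟨C c, isHomogeneous_C _ _, by simpa using hc⟩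
    | succ d ih =>
      intro t ht
      rw [pow_succ] at ht
      induction ht using Submodule.mul_induction_on' with
      | mem_mul_mem a ha b hb =>
        obtain ⟨P, hP, haP⟩ := ih a ha
        have hb' := hb
        rw [← hx] at hb
        obtain ⟨c, rfl⟩ := (Ideal.mem_span_range_iff_exists_fun).1 hb
        choose k hk using fun i => hK (c i)
        have hQ : (∑ i, C (k i) * X i : MvPolynomial σ K).IsHomogeneous 1 :=
          IsHomogeneous.sum _ _ _ fun i _ => by
            simpa using (isHomogeneous_C _ (k i)).mul (isHomogeneous_X K i)
        refine ⟨P * ∑ i, C (k i) * X i, hP.mul hQ, ?_⟩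
        have h2 : a * ∑ i, c i * x i - aeval x (P * ∑ i, C (k i) * X i) =
            (a - aeval x P) * ∑ i, c i * x i +
              aeval x P * ∑ i, (c i - algebraMap K T (k i)) * x i := by
          simp [sub_mul, mul_sub, Finset.sum_sub_distrib]
        rw [h2]
        refine add_mem ?_ ?_
        · rw [pow_succ _ (d + 1)]
          exact Ideal.mul_mem_mul haP hb'
        · rw [add_assoc, pow_add]
          refine Ideal.mul_mem_mul (haeval d P hP) (Ideal.sum_mem _ fun i _ => ?_)
          rw [pow_two]
          exact Ideal.mul_mem_mul (hk i) (hmem i)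
      | add a _ b _ ha hb =>
        obtain ⟨P, hP, haP⟩ := ha
        obtain ⟨Q, hQ, hbQ⟩ := hb
        exact ⟨P + Q, hP.add hQ, by
          rw [map_add, add_sub_add_comm]
          exact add_mem haP hbQ⟩
  refine isNoetherianRing_iff_ideal_fg T |>.2 fun I => ?_
  -- The initial forms of elements of I. By Hilbert's basis theorem finitely many generate their
  -- ideal, and the corresponding elements of I generate I by completeness; the sum of the degrees
  -- serves as the shift constant.
  let L : Set (MvPolynomial σ K) := {P | ∃ d, ∃ g ∈ I, P.IsHomogeneous d ∧ aeval x P - g ∈ m ^ (d + 1)}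
  obtain ⟨s, hsL, hs⟩ := Submodule.fg_span_iff_fg_span_finset_subset L |>.1
    (IsNoetherian.noetherian (Ideal.span L))
  choose d g hgI hhom hg using fun P : s => hsL P.2
  refine fg_of_forall_exists_sub_mem (m := m) g (∑ P, d P) I hgI fun D t ht => ?_
  obtain ⟨P, hP, htP⟩ := happrox D t ht.2
  have hPL : P ∈ Submodule.span (MvPolynomial σ K) (s : Set (MvPolynomial σ K)) := by
    rw [← hs]
    refine Submodule.subset_span ⟨D, t, ht.1, hP, ?_⟩
    rw [← neg_sub]
    exact neg_mem htP
  obtain ⟨c, hc⟩ := Submodule.mem_span_finset'.1 hPL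
  have hPD : P = ∑ Q : s, (if d Q ≤ D then homogeneousComponent (D - d Q) (c Q) else 0) * Q := by
    conv_lhs => rw [← (homogeneousComponent_of_mem hP).trans (if_pos rfl), ← hc, map_sum]
    refine Finset.sum_congr rfl fun Q _ => ?_
    rw [smul_eq_mul, homogeneousComponent_mul_of_isHomogeneous _ _ (hhom Q)]
    split_ifs <;> simp
  refine ⟨fun Q => if d Q ≤ D then aeval x (homogeneousComponent (D - d Q) (c Q)) else 0,
    fun Q => ?_, ?_⟩
  · dsimp only
    split_ifs
    · refine Ideal.pow_le_pow_right ?_ (haeval _ _ (homogeneousComponent_isHomogeneous _ _))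
      have := Finset.single_le_sum (f := d) (fun _ _ => Nat.zero_le _) (Finset.mem_univ Q)
      omega
    · exact zero_mem _
  · have h3 : t - ∑ Q : s, (if d Q ≤ D then aeval x (homogeneousComponent (D - d Q) (c Q)) else 0) * g Q
        = (t - aeval x P) + ∑ Q : s, (if d Q ≤ D then
          aeval x (homogeneousComponent (D - d Q) (c Q)) else 0) * (aeval x (Q : MvPolynomial σ K) - g Q) := by
      conv_rhs => rw [hPD]
      rw [map_sum]
      simp only [mul_sub, Finset.sum_sub_distrib, map_mul]
      have : ∀ Q : s, aeval x (if d Q ≤ D then homogeneousComponent (D - d Q) (c Q) else 0) =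
        if d Q ≤ D then aeval x (homogeneousComponent (D - d Q) (c Q)) else 0 := fun Q => by
        split_ifs <;> simp
      simp only [this]
      ring
    rw [h3]
    refine add_mem htP (Ideal.sum_mem _ fun Q _ => ?_)
    split_ifs with h
    · have h4 := Ideal.mul_mem_mul (haeval _ _ (homogeneousComponent_isHomogeneous (D - d Q) (c Q)))
        (hg Q)
      rw [← pow_add] at h4
      exact Ideal.pow_le_pow_right (by omega) h4
    · simp

end CompleteNoetherian

theorem IsPrecomplete.pi_const {T : Type*} [CommRing T] (m : Ideal T) [IsPrecomplete m T] (l : ℕ) :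
    IsPrecomplete m (Fin l → T) := by
  refine ⟨fun f hf => ?_⟩
  choose L hL using fun i => IsPrecomplete.prec' (I := m) (fun a => f a i) (fun {a b} hab => by
    have h1 := hf hab
    rw [SModEq.sub_mem] at h1 ⊢
    rw [smul_eq_mul, Ideal.mul_top]
    exact forall_mem_of_mem_smul_top _ h1 i)
  refine ⟨L, fun n => ?_⟩
  rw [SModEq.sub_mem]
  refine mem_smul_top_of_forall_mem _ fun i => ?_
  have h1 := hL i n
  rw [SModEq.sub_mem, smul_eq_mul, Ideal.mul_top] at h1
  exact h1

/-- A complete Noetherian ring of characteristic `p` with perfect residue field is finite over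
itself by the Frobenius. -/
theorem finite_frobenius_of_isAdicComplete {T : Type u} [CommRing T] [IsNoetherianRing T]
    (m : Ideal T) [IsAdicComplete m T] (p : ℕ) [Fact p.Prime] [CharP T p]
    (hm : ∀ t : T, ∃ s : T, t - s ^ p ∈ m) :
    Module.Finite T ((ModuleCat.restrictScalars (frobenius T p)).obj (ModuleCat.of T T)) := by
  let N : Type u := (ModuleCat.restrictScalars (frobenius T p)).obj (ModuleCat.of T T)
  let ν : T → N := fun t => t
  have hsmul : ∀ a t : T, a • ν t = ν (a ^ p * t) := fun a t => rfl
  have hadd : ∀ a b : T, ν (a + b) = ν a + ν b := fun a b => rfl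
  have hsum : ∀ (s : Finset T) (f : T → T), ν (∑ y ∈ s, f y) = ∑ y ∈ s, ν (f y) := fun s f => rfl
  -- A remainder in m^n is a combination of generators of m^n; replacing the coefficients by p-th
  -- powers modulo m pushes the error into m^(n+1).
  have h1 : ∀ n : ℕ, ∃ W : Finset T, ∀ t : T, ∃ w ∈ Submodule.span T (ν '' W), ∃ r ∈ m ^ n,
      ν t = w + ν r := by
    classical
    intro n
    induction n with
    | zero => exact ⟨∅, fun t => ⟨0, zero_mem _, t, by simp, (zero_add _).symm⟩⟩
    | succ n ih =>
      obtain ⟨W, hW⟩ := ih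
      obtain ⟨Y, hY⟩ := (IsNoetherian.noetherian (m ^ n) : (m ^ n).FG)
      refine ⟨W ∪ Y, fun t => ?_⟩
      obtain ⟨w, hw, r, hr, ht⟩ := hW t
      rw [← hY] at hr
      obtain ⟨c, -, hc⟩ := Submodule.mem_span_finset.1 hr
      choose s hs using fun y => hm (c y)
      refine ⟨w + ∑ y ∈ Y, s y • ν y, add_mem (Submodule.span_mono (Set.image_mono
        (by simp)) hw) (Submodule.sum_mem _ fun y hy => Submodule.smul_mem _ _
          (Submodule.subset_span ⟨y, by simp [Finset.mem_coe.1 hy], rfl⟩)),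
        ∑ y ∈ Y, (c y - s y ^ p) * y, Ideal.sum_mem _ fun y hy => ?_, ?_⟩
      · rw [pow_succ']
        exact Ideal.mul_mem_mul (hs y) (hY ▸ Ideal.subset_span hy)
      · rw [ht, add_assoc, ← hc]
        congr 1
        simp only [hsmul, ← hsum, ← hadd, ← Finset.sum_add_distrib]
        refine congrArg ν (Finset.sum_congr rfl fun y _ => ?_)
        rw [smul_eq_mul]; ring
  -- Some power of m lies in the ideal generated by p-th powers, and that ideal is mN for the
  -- Frobenius module N. Generating modulo m^k therefore generates N modulo m, and completeness
  -- lifts this to N.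
  obtain ⟨k, hk⟩ := Ideal.exists_pow_le_of_le_radical_of_fg (I := m) (J := m.map (frobenius T p))
    (fun t ht => ⟨p, Ideal.mem_map_of_mem (frobenius T p) ht⟩) (IsNoetherian.noetherian m)
  have h2 : ∀ n, ∀ t ∈ (m ^ n).map (frobenius T p), ∀ c : T,
      ν (c * t) ∈ (m ^ n • ⊤ : Submodule T N) := by
    intro n t ht
    induction ht using Submodule.span_induction with
    | mem t ht =>
      intro c
      obtain ⟨a, ha, rfl⟩ := ht
      have : ν (c * frobenius T p a) = a • ν c := by rw [hsmul, mul_comm]; rfl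
      rw [this]
      exact Submodule.smul_mem_smul ha trivial
    | zero =>
      intro c
      rw [mul_zero]
      exact zero_mem _
    | add a b _ _ ha hb =>
      intro c
      rw [mul_add, hadd]
      exact add_mem (ha c) (hb c)
    | smul a b _ hb =>
      intro c
      rw [smul_eq_mul, ← mul_assoc]
      exact hb _
  have h3 : ∀ n, ∀ t : N, t ∈ (m ^ n • ⊤ : Submodule T N) → (show T from t) ∈ m ^ n := by
    intro n t ht
    induction ht using Submodule.smul_induction_on' with
    | smul a ha x _ =>
      exact Ideal.mul_mem_right _ _ (Ideal.pow_mem_of_mem _ ha p (Fact.out : p.Prime).pos)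
    | add a _ b _ ha hb => exact add_mem ha hb
  have : IsHausdorff m N := ⟨fun t ht => by
    refine IsHausdorff.haus' (I := m) (show T from t) fun n => ?_
    have h4 := ht n
    rw [SModEq.zero] at h4 ⊢
    rw [smul_eq_mul, Ideal.mul_top]
    exact h3 n t h4⟩
  obtain ⟨W, hW⟩ := h1 k
  have := IsPrecomplete.pi_const m W.card
  let f : (Fin W.card → T) →ₗ[T] N := Fintype.linearCombination T
    (fun i => ν (W.equivFin.symm i))
  have hf : LinearMap.range f = Submodule.span T (ν '' W) := by
    rw [Fintype.range_linearCombination]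
    congr 1
    ext y
    constructor
    · rintro ⟨i, rfl⟩
      exact ⟨_, (W.equivFin.symm i).2, rfl⟩
    · rintro ⟨y, hy, rfl⟩
      exact ⟨W.equivFin ⟨y, hy⟩, by simp⟩
  refine Module.Finite.of_surjective f (surjective_of_mkQ_comp_surjective (I := m) fun y => ?_)
  obtain ⟨t, rfl⟩ := Submodule.mkQ_surjective _ y
  obtain ⟨w, hw, r, hr, ht⟩ := hW t
  rw [← hf] at hw
  obtain ⟨v, rfl⟩ := hw
  refine ⟨v, ?_⟩
  have h5 : ν r ∈ (m • ⊤ : Submodule T N) := by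
    have := h2 1 r (by rw [pow_one]; exact hk hr) 1
    rwa [pow_one, one_mul] at this
  have h6 : (t : N) = f v + ν r := ht
  rw [LinearMap.comp_apply, h6, map_add]
  exact ((add_eq_left).2 ((Submodule.Quotient.mk_eq_zero _).2 h5)).symm

/-! ### Flat F-finite local extensions -/

section CompletionOfFlat

theorem isMaximal_of_forall_exists_sub_mem {K B : Type*} [Field K] [CommRing B] [Algebra K B]
    (𝔫 : Ideal B) (h : 𝔫 ≠ ⊤) (hK : ∀ b : B, ∃ c : K, b - algebraMap K B c ∈ 𝔫) :
    𝔫.IsMaximal := by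
  refine Ideal.isMaximal_iff.2 ⟨(Ideal.ne_top_iff_one 𝔫).1 h, fun J x hJ hx hxJ => ?_⟩
  obtain ⟨c, hc⟩ := hK x
  have hc0 : c ≠ 0 := by
    rintro rfl
    exact hx (by simpa using hc)
  have h1 : algebraMap K B c ∈ J := by
    have := sub_mem hxJ (hJ hc)
    rwa [sub_sub_cancel] at this
  have h2 := J.mul_mem_left (algebraMap K B c⁻¹) h1
  rwa [← map_mul, inv_mul_cancel₀ hc0, map_one] at h2

theorem mem_map_pow_iff_eval_eq_zero {B : Type*} [CommRing B] {I : Ideal B} (hI : I.FG) (n : ℕ)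
    (t : AdicCompletion I B) :
    t ∈ (I ^ n).map (algebraMap B (AdicCompletion I B)) ↔ AdicCompletion.eval I B n t = 0 := by
  rw [← LinearMap.mem_ker, ← AdicCompletion.pow_smul_top_eq_ker_eval hI, Ideal.smul_top_eq_map]
  rfl

/-- The witness is the adic completion. The last two clauses are surjectivity and injectivity of
B/𝔫ⁿ → T/𝔫ⁿT, in the form used by `flat_of_adic_approximation`. -/
theorem exists_isAdicComplete (B : Type u) [CommRing B] (𝔫 : Ideal B) [𝔫.IsMaximal] (h𝔫 : 𝔫.FG) :
    ∃ (T : Type u) (_ : CommRing T) (f : B →+* T), IsAdicComplete (𝔫.map f) T ∧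
      (𝔫.map f).IsMaximal ∧ (∀ n (t : T), ∃ b : B, t - f b ∈ (𝔫 ^ n).map f) ∧
      ∀ n (b : B), f b ∈ (𝔫 ^ n).map f → b ∈ 𝔫 ^ n := by
  refine ⟨AdicCompletion 𝔫 B, inferInstance, algebraMap B _, AdicCompletion.isAdicComplete_self 𝔫 h𝔫,
    AdicCompletion.isMaximal_map_of_le 𝔫 𝔫 le_rfl h𝔫, fun n t => ?_, fun n b hb => ?_⟩
  · obtain ⟨b, hb⟩ := Submodule.mkQ_surjective _ (AdicCompletion.eval 𝔫 B n t)
    refine ⟨b, ?_⟩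
    rw [mem_map_pow_iff_eval_eq_zero h𝔫, map_sub, ← hb]
    exact sub_self _
  · rw [mem_map_pow_iff_eval_eq_zero h𝔫] at hb
    have h3 : (Submodule.Quotient.mk b : B ⧸ (𝔫 ^ n • ⊤ : Submodule B B)) = 0 := hb
    rwa [Submodule.Quotient.mk_eq_zero, smul_eq_mul, Ideal.mul_top] at h3

/-- B need not be Noetherian, so flatness of its completion comes from adic approximation and
Noetherianity from the coefficient field K. Perfectness of K gives F-finiteness. -/
theorem exists_completion_of_flat (p : ℕ) [Fact p.Prime] (R B K : Type u) [CommRing R]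
    [IsNoetherianRing R] [CommRing B] [Algebra R B] [Module.Flat R B] [Field K] [Algebra K B]
    [CharP K p] (hp : ∀ c : K, ∃ d : K, d ^ p = c) (m : Ideal R)
    (h : m.map (algebraMap R B) ≠ ⊤)
    (hK : ∀ b : B, ∃ c : K, b - algebraMap K B c ∈ m.map (algebraMap R B)) :
    ∃ (T : Type u) (_ : CommRing T) (_ : CharP T p) (f : R →+* T),
      IsNoetherianRing T ∧ IsLocalRing T ∧ f.Flat ∧ (m.map f).IsMaximal ∧
      Module.Finite T ((ModuleCat.restrictScalars (frobenius T p)).obj (ModuleCat.of T T)) ∧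
      ∀ t : T, ∃ s : T, t - s ^ p ∈ m.map f := by
  set 𝔫 := m.map (algebraMap R B) with h𝔫
  have hmax : 𝔫.IsMaximal := isMaximal_of_forall_exists_sub_mem 𝔫 h hK
  have hfg : m.FG := IsNoetherian.noetherian m
  have h𝔫fg : 𝔫.FG := hfg.map _
  obtain ⟨T, _, ι, hcompl, hTmax, h1, h2⟩ := exists_isAdicComplete B 𝔫 h𝔫fg
  let f : R →+* T := ι.comp (algebraMap R B)
  let _ : Algebra B T := ι.toAlgebra
  let _ : Algebra R T := f.toAlgebra
  let _ : Algebra K T := (ι.comp (algebraMap K B)).toAlgebra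
  have : IsScalarTower R B T := IsScalarTower.of_algebraMap_eq fun _ => rfl
  have hmf : ∀ n, (m ^ n).map f = (𝔫 ^ n).map ι := fun n => by
    rw [← Ideal.map_map, Ideal.map_pow]
  have hmf1 : m.map f = 𝔫.map ι := by
    simpa using hmf 1
  rw [← hmf1] at hcompl hTmax
  simp only [← hmf] at h1 h2
  have hloc : IsLocalRing T := isLocalRing_of_isAdicComplete_maximal (m.map f)
  have hKT : ∀ t : T, ∃ c : K, t - algebraMap K T c ∈ m.map f := fun t => by
    obtain ⟨b, hb⟩ := h1 1 t
    obtain ⟨c, hc⟩ := hK b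
    refine ⟨c, ?_⟩
    rw [pow_one] at hb
    have h3 := add_mem hb (hmf1 ▸ Ideal.mem_map_of_mem ι hc)
    rw [map_sub, sub_add_sub_cancel] at h3
    exact h3
  have hnoeth : IsNoetherianRing T := by
    obtain ⟨s, hs⟩ := hfg
    refine isNoetherianRing_of_isAdicComplete (m := m.map f) (fun y : s => f y) ?_ hKT
    rw [← hs, Ideal.map_span]
    congr 1
    ext t
    simp
  have hchar : CharP T p := charP_of_injective_algebraMap (algebraMap K T).injective p
  have hperf : ∀ t : T, ∃ s : T, t - s ^ p ∈ m.map f := fun t => by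
    obtain ⟨c, hc⟩ := hKT t
    obtain ⟨d, rfl⟩ := hp c
    exact ⟨algebraMap K T d, by rwa [← map_pow]⟩
  refine ⟨T, inferInstance, hchar, f, hnoeth, hloc, ?_, hTmax,
    finite_frobenius_of_isAdicComplete (m.map f) p hperf, hperf⟩
  exact (RingHom.flat_algebraMap_iff (R := R) (S := T)).2
    (flat_of_adic_approximation R B T m hTmax.ne_top h1
      (fun n b hb => by rw [Ideal.map_pow]; exact h2 n b hb))

/-- The residue field is formally smooth over the prime field, so its identity map lifts to the
completion of R: this is Cohen's coefficient field. -/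
theorem exists_flat_extension_with_section (p : ℕ) [Fact p.Prime] (R : Type u) [CommRing R]
    [IsNoetherianRing R] [CharP R p] (m : Ideal R) [m.IsMaximal] :
    ∃ (C : Type u) (_ : CommRing C) (f : R →+* C) (ε : C →+* R ⧸ m) (g : R ⧸ m →+* C),
      f.Flat ∧ (∀ x, ε (f x) = Ideal.Quotient.mk m x) ∧ (∀ c, ε (g c) = c) ∧
      ∀ x, x - g (ε x) ∈ m.map f := by
  let _ : Algebra (ZMod p) R := ZMod.algebra R p
  let _ : Field (R ⧸ m) := Ideal.Quotient.field m
  have hsm : Algebra.FormallySmooth (ZMod p) (R ⧸ m) :=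
    Algebra.FormallySmooth.of_perfect (ZMod p) (R ⧸ m)
  obtain ⟨g, hg⟩ := Algebra.FormallySmooth.exists_adicCompletionEvalOneₐ_comp_eq
    (AlgHom.id (ZMod p) (R ⧸ m))
  have hev : ∀ c, AdicCompletion.evalOneₐ m (g c) = c := fun c => DFunLike.congr_fun hg c
  refine ⟨AdicCompletion m R, inferInstance, algebraMap R _, (AdicCompletion.evalOneₐ m).toRingHom,
    g.toRingHom, (RingHom.flat_algebraMap_iff (R := R)).2 inferInstance,
    fun x => (AdicCompletion.evalOneₐ m).commutes x, hev, fun x => ?_⟩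
  rw [← AdicCompletion.ker_evalOneₐ_eq_map m (IsNoetherian.noetherian m), RingHom.mem_ker]
  change AdicCompletion.evalOneₐ m (x - g (AdicCompletion.evalOneₐ m x)) = 0
  rw [map_sub, hev, sub_self]

/-- A Noetherian ring of characteristic `p` has, for each maximal ideal `m`, a flat extension to a
complete local F-finite ring with maximal ideal generated by `m` and perfect residue field. -/
theorem exists_flat_local_extension (p : ℕ) [Fact p.Prime] (R : Type u) [CommRing R]
    [IsNoetherianRing R] [CharP R p] (m : Ideal R) [m.IsMaximal] :
    ∃ (T : Type u) (_ : CommRing T) (_ : CharP T p) (f : R →+* T),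
      IsNoetherianRing T ∧ IsLocalRing T ∧ f.Flat ∧ (m.map f).IsMaximal ∧
      Module.Finite T ((ModuleCat.restrictScalars (frobenius T p)).obj (ModuleCat.of T T)) ∧
      ∀ t : T, ∃ s : T, t - s ^ p ∈ m.map f := by
  obtain ⟨C, _, f, ε, g, hf, hεf, hεg, hg⟩ := exists_flat_extension_with_section p R m
  let k := R ⧸ m
  let _ : Field k := Ideal.Quotient.field m
  let K := AlgebraicClosure k
  have : CharP k p := by
    let _ : Algebra (ZMod p) k := ((Ideal.Quotient.mk m).comp (ZMod.castHom dvd_rfl R)).toAlgebra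
    exact charP_of_injective_algebraMap (algebraMap (ZMod p) k).injective p
  have : CharP K p := charP_of_injective_algebraMap (algebraMap k K).injective p
  let _ : Algebra k C := g.toAlgebra
  let _ : Algebra R C := f.toAlgebra
  -- The coefficient field allows the residue field to be enlarged to its algebraic closure by a
  -- flat tensor product.
  let B := TensorProduct k C K
  have : Module.Flat R C := (RingHom.flat_algebraMap_iff (R := R) (S := C)).1 hf
  have : Module.Flat R B := Module.Flat.trans R C B
  let _ : Algebra K B := (Algebra.TensorProduct.includeRight : K →ₐ[k] B).toRingHom.toAlgebra
  have hmapB : m.map (algebraMap R B) = (m.map f).map (algebraMap C B) := by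
    rw [Ideal.map_map, IsScalarTower.algebraMap_eq R C B]
    rfl
  refine exists_completion_of_flat p R B K (fun c => IsAlgClosed.exists_pow_nat_eq c
    (Fact.out : p.Prime).pos) m ?_ ?_
  · let ε' : C →ₐ[k] K :=
      { ((algebraMap k K).comp ε) with
        commutes' := fun c => congrArg (algebraMap k K) (hεg c) }
    let θ : B →ₐ[k] K := Algebra.TensorProduct.lift ε' (AlgHom.id k K) fun _ _ => Commute.all _ _
    have hle : m.map (algebraMap R B) ≤ RingHom.ker θ := by
      rw [Ideal.map_le_iff_le_comap]
      intro x hx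
      rw [Ideal.mem_comap, RingHom.mem_ker]
      have h1 : θ (f x ⊗ₜ[k] (1 : K)) = algebraMap k K (ε (f x)) * 1 :=
        Algebra.TensorProduct.lift_tmul _ _ _ _ _
      refine h1.trans ?_
      rw [hεf, Ideal.Quotient.eq_zero_iff_mem.2 hx, map_zero, zero_mul]
    intro htop
    rw [htop, top_le_iff] at hle
    exact RingHom.ker_ne_top θ hle
  · intro b
    induction b using TensorProduct.induction_on with
    | zero => exact ⟨0, by simp⟩
    | tmul x c =>
      refine ⟨ε x • c, ?_⟩
      have h1 : x ⊗ₜ[k] c - algebraMap K B (ε x • c) =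
          algebraMap C B (x - g (ε x)) * ((1 : C) ⊗ₜ[k] c) := by
        have h2 : algebraMap K B (ε x • c) = (g (ε x) : C) ⊗ₜ[k] c := by
          change (1 : C) ⊗ₜ[k] (ε x • c) = _
          rw [← TensorProduct.smul_tmul, Algebra.smul_def, mul_one]
          rfl
        have h3 : algebraMap C B (x - g (ε x)) = (x - g (ε x)) ⊗ₜ[k] (1 : K) := rfl
        rw [h2, h3, Algebra.TensorProduct.tmul_mul_tmul, mul_one, one_mul, TensorProduct.sub_tmul]
      rw [h1, hmapB]
      exact Ideal.mul_mem_right _ _ (Ideal.mem_map_of_mem _ (hg x))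
    | add a b ha hb =>
      obtain ⟨c, hc⟩ := ha
      obtain ⟨d, hd⟩ := hb
      refine ⟨c + d, ?_⟩
      rw [map_add, add_sub_add_comm]
      exact add_mem hc hd

end CompletionOfFlat

/-! ### Approximate linear recursions -/

section Sequences

open Filter

/-- A bounded sequence which satisfies a linear recursion up to a geometrically small error
converges. -/
theorem exists_tendsto_of_abs_sub_le {u : ℕ → ℝ} {c K ρ M : ℝ} (hc : 0 ≤ c)
    (hρ0 : 0 < ρ) (hρ1 : ρ < 1) (hM : ∀ n, |u n| ≤ M)
    (h : ∀ n, |u (n + 1) - c * u n| ≤ K * ρ ^ n) : ∃ L, Tendsto u atTop (nhds L) := by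
  rcases lt_trichotomy c 1 with hc1 | rfl | hc1
  · obtain ⟨σ, hσ, hσ1⟩ := exists_between (max_lt hc1 hρ1)
    have hcσ : c < σ := (le_max_left c ρ).trans_lt hσ
    have hρσ : ρ < σ := (le_max_right c ρ).trans_lt hσ
    have hσ0 : 0 < σ := hρ0.trans hρσ
    have hK : 0 ≤ K := by
      have := (abs_nonneg _).trans (h 0)
      simpa using this
    -- The bound A σ^n starts above |u 0| and has room A(σ - c) ≥ K to absorb the error at each
    -- step.
    let A := max |u 0| (K / (σ - c))
    have hA : K ≤ A * (σ - c) := by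
      rw [← div_le_iff₀ (sub_pos.2 hcσ)]
      exact le_max_right _ _
    have hA0 : 0 ≤ A := (abs_nonneg (u 0)).trans (le_max_left _ _)
    have key : ∀ n, |u n| ≤ A * σ ^ n := fun n => by
      induction n with
      | zero => rw [pow_zero, mul_one]; exact le_max_left _ _
      | succ n ih =>
        have h1 : |u (n + 1)| ≤ |u (n + 1) - c * u n| + c * |u n| := by
          have := abs_add_le (u (n + 1) - c * u n) (c * u n)
          rwa [sub_add_cancel, abs_mul, abs_of_nonneg hc] at this
        have h2 : ρ ^ n ≤ σ ^ n := pow_le_pow_left₀ hρ0.le hρσ.le n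
        calc |u (n + 1)| ≤ K * ρ ^ n + c * (A * σ ^ n) :=
              h1.trans (add_le_add (h n) (mul_le_mul_of_nonneg_left ih hc))
          _ ≤ A * (σ - c) * σ ^ n + c * (A * σ ^ n) := by
              gcongr
          _ = A * σ ^ (n + 1) := by ring
    refine ⟨0, squeeze_zero_norm key ?_⟩
    simpa using (tendsto_pow_atTop_nhds_zero_of_lt_one hσ0.le hσ1).const_mul A
  · refine cauchySeq_tendsto_of_complete (cauchySeq_of_le_geometric ρ K hρ1 fun n => ?_)
    rw [dist_comm, Real.dist_eq]
    simpa using h n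
  · have hρc : 0 < c - ρ := by linarith
    -- With this A, cAρ^n - Kρ^n = Aρ^(n+1). A positive excess of |u n| over Aρ^n is then multiplied
    -- by at least c > 1 at each step, against boundedness.
    let A := K / (c - ρ)
    have hA : A * (c - ρ) = K := div_mul_cancel₀ _ hρc.ne'
    have key : ∀ n, |u n| ≤ A * ρ ^ n := by
      by_contra! hcon
      obtain ⟨n, hn⟩ := hcon
      have hstep : ∀ k, c ^ k * (|u n| - A * ρ ^ n) ≤ |u (n + k)| - A * ρ ^ (n + k) := fun k => by
        induction k with
        | zero => simp
        | succ k ih =>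
          have h1 : c * |u (n + k)| ≤ |u (n + k + 1)| + K * ρ ^ (n + k) := by
            have := abs_sub_abs_le_abs_sub (c * u (n + k)) (u (n + k + 1))
            rw [abs_sub_comm, abs_mul, abs_of_nonneg hc] at this
            linarith [h (n + k)]
          calc c ^ (k + 1) * (|u n| - A * ρ ^ n) = c * (c ^ k * (|u n| - A * ρ ^ n)) := by ring
            _ ≤ c * (|u (n + k)| - A * ρ ^ (n + k)) := mul_le_mul_of_nonneg_left ih hc
            _ ≤ |u (n + k + 1)| + K * ρ ^ (n + k) - c * (A * ρ ^ (n + k)) := by linarith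
            _ = |u (n + (k + 1))| - A * ρ ^ (n + (k + 1)) := by
              rw [← hA, ← add_assoc]; ring
      have hK : 0 ≤ K := by
        have := (abs_nonneg _).trans (h 0)
        simpa using this
      have hA0 : 0 ≤ A := div_nonneg hK hρc.le
      obtain ⟨k, hk⟩ := ((tendsto_pow_atTop_atTop_of_one_lt hc1).atTop_mul_const
        (sub_pos.2 hn)).eventually_gt_atTop M |>.exists
      have h3 : 0 ≤ A * ρ ^ (n + k) := by positivity
      linarith [hstep k, hM (n + k)]
    refine ⟨0, squeeze_zero_norm key ?_⟩
    simpa using (tendsto_pow_atTop_nhds_zero_of_lt_one hρ0.le hρ1).const_mul A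

end Sequences

section Dimension

/-- The height of mT is at most the height of m plus its height in the fibre T/mT, and the latter is
0. -/
theorem coheight_lt_of_isMaximal_map {R : Type u} {T : Type v} [CommRing R] [IsNoetherianRing R]
    [FiniteRingKrullDim R] [CommRing T] [IsNoetherianRing T] [IsLocalRing T] (f : R →+* T)
    (m : Ideal R) [m.IsMaximal] (h : (m.map f).IsMaximal) (P : PrimeSpectrum T) :
    Order.coheight P < (krullDimNat R : ℕ∞) + 1 := by
  let _ := f.toAlgebra
  have hlo : (m.map f).LiesOver m := ⟨((Ideal.IsMaximal.eq_of_le ‹m.IsMaximal›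
    (Ideal.comap_ne_top f h.ne_top) Ideal.le_comap_map))⟩
  have h1 := Ideal.height_le_height_add_of_liesOver m (m.map f)
  have h2 : ((m.map f).map (Ideal.Quotient.mk (m.map (algebraMap R T)))).height = 0 := by
    have : (m.map f).map (Ideal.Quotient.mk (m.map (algebraMap R T))) = ⊥ :=
      Ideal.map_quotient_self _
    rw [this]
    have hp : (m.map (algebraMap R T)).IsPrime := h.isPrime
    exact Ideal.height_eq_zero_iff_eq_bot.2 rfl
  rw [h2, add_zero] at h1
  have hmax : m.map f = IsLocalRing.maximalIdeal T := IsLocalRing.eq_maximalIdeal h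
  rw [hmax] at h1
  have h3 : (IsLocalRing.maximalIdeal T).height ≤ (krullDimNat R : ℕ∞) := by
    refine h1.trans (WithBot.coe_le_coe.1 ?_)
    rw [← ringKrullDim_eq_krullDimNat]
    exact Ideal.height_le_ringKrullDim_of_ne_top (Ideal.IsMaximal.ne_top ‹_›)
  have h4 := Order.coheight_le_krullDim P
  change _ ≤ ringKrullDim T at h4
  rw [← IsLocalRing.maximalIdeal_height_eq_ringKrullDim, WithBot.coe_le_coe] at h4
  exact (ENat.lt_add_one_iff (ENat.natCast_ne_top _)).2 (h4.trans h3)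

end Dimension

section RestrictScalars

variable {A B C : Type u} [CommRing A] [CommRing B] [CommRing C]

/-- Taking g to be Frobenius, this trades restriction of the coefficient module for one more
Frobenius twist of the complex. -/
theorem tensorChi_restrictScalars (φ : A →+* B) (g : B →+* C) (G : ChainComplex (ModuleCat.{u} A) ℕ)
    (h : ∀ m : Ideal C, m.IsMaximal → Module.length B ((ModuleCat.restrictScalars.{u} g).obj
      (ModuleCat.of C (C ⧸ m))) = 1) (M : ModuleCat.{u} C)
    (hM : ∀ i, homologyLength (g.comp φ) M G i ≠ ⊤) :
    tensorChi φ G ((ModuleCat.restrictScalars g).obj M) = tensorChi (g.comp φ) G M := by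
  refine finsum_congr fun i => ?_
  have h1 : Module.length B ((tensorComplex φ ((ModuleCat.restrictScalars g).obj M) G).homology i) =
      Module.length C ((tensorComplex (g.comp φ) M G).homology i) := by
    have h2 := length_homology_restrictScalars g (tensorComplex (g.comp φ) M G) i
    have h3 := length_restrictScalars_eq g h (Module.length_ne_top_iff.1 (hM i))
    exact h2.trans h3
  change (-1) ^ i * ((Module.length B ((tensorComplex φ ((ModuleCat.restrictScalars g).obj M) G).homology i)).toNat : ℤ) =
    (-1) ^ i * ((Module.length C ((tensorComplex (g.comp φ) M G).homology i)).toNat : ℤ)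
  rw [h1]

end RestrictScalars

/-! ### Convergence over F-finite rings -/

section LimitOverFFinite

variable {A T : Type u} [CommRing A] [CommRing T] {p : ℕ} [Fact p.Prime] [CharP A p] [CharP T p]
  {f : A →+* T} {X : Set T} {G : ChainComplex (ModuleCat.{u} A) ℕ}

-- The rank comparison for N together with the shift gives the normalised sequence a recursion with
-- factor rank(N)/p^d and error O(p^(-n)); the growth bound for D makes it bounded.
omit [CharP T p] in
theorem exists_tendsto_tensorChi_of_shift [IsNoetherianRing T]
    (F : PowerAnnihilatedFamily (frobeniusComp p f) (fun n => p ^ n) X G)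
    (hbdd : IsBoundedComplex G) {d : ℕ} (hd : ∀ P : PrimeSpectrum T, Order.coheight P < d + 1)
    (D N : Type u) [CommRing D] [IsDomain D] [Algebra T D]
    (hD : Function.Surjective (algebraMap T D)) [AddCommGroup N] [Module D N] [Module T N]
    [IsScalarTower T D N] [Module.Finite D N]
    (hshift : ∀ n, tensorChi (frobeniusComp p f n) G N = tensorChi (frobeniusComp p f (n + 1)) G D) :
    ∃ L, Filter.Tendsto (fun n => (tensorChi (frobeniusComp p f n) G D : ℝ) /
      (p : ℝ) ^ (n * d)) Filter.atTop (nhds L) := by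
  have hp : p.Prime := Fact.out
  have hp0 : (0 : ℝ) < p := by exact_mod_cast hp.pos
  have hd' : ∀ P : PrimeSpectrum T, Order.coheight P < (d + 1 : ℕ) := by exact_mod_cast hd
  have : Module.Finite T D := Module.Finite.of_surjective (Algebra.linearMap T D) hD
  obtain ⟨c, hc⟩ := F.exists_abs_tensorChi_sub_le hbdd hd D N hD
  obtain ⟨c', hc'⟩ := F.exists_abs_tensorChi_le hbdd (d + 1) D fun Q _ => hd' Q
  set a : ℕ → ℤ := fun n => tensorChi (frobeniusComp p f n) G D with ha
  refine exists_tendsto_of_abs_sub_le (c := Module.finrank D N / (p : ℝ) ^ d) (ρ := (p : ℝ)⁻¹)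
    (K := c / (p : ℝ) ^ d) (M := c') (by positivity) (by positivity)
    (inv_lt_one_of_one_lt₀ (by exact_mod_cast hp.one_lt)) (fun n => ?_) (fun n => ?_)
  · have h1 : |(a n : ℝ)| * (p : ℝ) ^ n ≤ c' * ((p : ℝ) ^ n) ^ (d + 1) := by exact_mod_cast hc' n
    rw [abs_div, abs_of_pos (by positivity : (0 : ℝ) < (p : ℝ) ^ (n * d)), div_le_iff₀ (by positivity),
      pow_mul]
    rw [pow_succ, ← mul_assoc] at h1
    exact le_of_mul_le_mul_right h1 (by positivity)
  · have h1 : |(a (n + 1) : ℝ) - Module.finrank D N * a n| * (p : ℝ) ^ n ≤ c * ((p : ℝ) ^ n) ^ d := by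
      have := hc n
      rw [hshift] at this
      exact_mod_cast this
    have h2 : (a (n + 1) : ℝ) / (p : ℝ) ^ ((n + 1) * d) -
        Module.finrank D N / (p : ℝ) ^ d * (a n / (p : ℝ) ^ (n * d)) =
        ((a (n + 1) : ℝ) - Module.finrank D N * a n) / (p : ℝ) ^ ((n + 1) * d) := by
      rw [add_mul, pow_add, one_mul]
      field_simp
    rw [h2, abs_div, abs_of_pos (by positivity : (0 : ℝ) < (p : ℝ) ^ ((n + 1) * d)),
      div_le_iff₀ (by positivity)]
    calc _ ≤ c * ((p : ℝ) ^ n) ^ d / (p : ℝ) ^ n := (le_div_iff₀ (by positivity)).2 h1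
      _ = _ := by
        rw [add_mul, pow_add, one_mul, pow_mul, inv_pow]
        field_simp

/-- Here N is T/P viewed through Frobenius: finite because T is F-finite, and of unchanged length
because Frobenius restriction keeps residue fields of length one. -/
theorem exists_tendsto_tensorChi_quotient [IsNoetherianRing T]
    (F : PowerAnnihilatedFamily (frobeniusComp p f) (fun n => p ^ n) X G)
    (hbdd : IsBoundedComplex G) {d : ℕ} (hd : ∀ P : PrimeSpectrum T, Order.coheight P < d + 1)
    (hfin : Module.Finite T ((ModuleCat.restrictScalars (frobenius T p)).obj (ModuleCat.of T T)))
    (hperf : ∀ m : Ideal T, m.IsMaximal → Module.length T ((ModuleCat.restrictScalars.{u}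
      (frobenius T p)).obj (ModuleCat.of T (T ⧸ m))) = 1) (P : Ideal T) [P.IsPrime] :
    ∃ L, Filter.Tendsto (fun n => (tensorChi (frobeniusComp p f n) G (T ⧸ P) : ℝ) /
      (p : ℝ) ^ (n * d)) Filter.atTop (nhds L) := by
  have hd' : ∀ P : PrimeSpectrum T, Order.coheight P < (d + 1 : ℕ) := by exact_mod_cast hd
  have : CharP (T ⧸ P) p := by
    let _ : Algebra (ZMod p) (T ⧸ P) :=
      ((Ideal.Quotient.mk P).comp (ZMod.castHom dvd_rfl T)).toAlgebra
    exact charP_of_injective_algebraMap (algebraMap (ZMod p) (T ⧸ P)).injective p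
  let N := (ModuleCat.restrictScalars (frobenius T p)).obj (ModuleCat.of T (T ⧸ P))
  let _ : Module (T ⧸ P) N := ((ModuleCat.restrictScalars (frobenius (T ⧸ P) p)).obj
    (ModuleCat.of (T ⧸ P) (T ⧸ P))).isModule
  have hNT : IsScalarTower T (T ⧸ P) N := IsScalarTower.of_algebraMap_smul fun t x => by
    change (Ideal.Quotient.mk P t) ^ p * (show T ⧸ P from x) =
      Ideal.Quotient.mk P (t ^ p) * (show T ⧸ P from x)
    rw [map_pow]
  have hNfin : Module.Finite T N := by
    let π : (ModuleCat.restrictScalars (frobenius T p)).obj (ModuleCat.of T T) ⟶ N :=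
      (ModuleCat.restrictScalars (frobenius T p)).map
        (ModuleCat.ofHom (Algebra.linearMap T (T ⧸ P)))
    have hπ : Function.Surjective π.hom := fun y => Ideal.Quotient.mk_surjective (I := P) y
    exact Module.Finite.of_surjective π.hom hπ
  have : Module.Finite (T ⧸ P) N := Module.Finite.of_restrictScalars_finite T (T ⧸ P) N
  refine exists_tendsto_tensorChi_of_shift F hbdd hd (T ⧸ P) N Ideal.Quotient.mk_surjective
    fun n => ?_
  have hcomp : (frobenius T p).comp (frobeniusComp p f n) = frobeniusComp p f (n + 1) := by
    ext x
    simp only [RingHom.comp_apply, frobeniusComp_apply, frobenius_def, pow_succ, pow_mul]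
  rw [← hcomp]
  exact tensorChi_restrictScalars (frobeniusComp p f n) (frobenius T p) G hperf
    (ModuleCat.of T (T ⧸ P)) (fun i => by
      rw [hcomp]
      exact F.homologyLength_ne_top hd' (T ⧸ P) (n + 1) i)

theorem exists_tendsto_tensorChi [IsNoetherianRing T]
    (F : PowerAnnihilatedFamily (frobeniusComp p f) (fun n => p ^ n) X G)
    (hbdd : IsBoundedComplex G) {d : ℕ} (hd : ∀ P : PrimeSpectrum T, Order.coheight P < d + 1)
    (hfin : Module.Finite T ((ModuleCat.restrictScalars (frobenius T p)).obj (ModuleCat.of T T)))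
    (hperf : ∀ m : Ideal T, m.IsMaximal → Module.length T ((ModuleCat.restrictScalars.{u}
      (frobenius T p)).obj (ModuleCat.of T (T ⧸ m))) = 1)
    (M : Type u) [AddCommGroup M] [Module T M] [hM : Module.Finite T M] :
    ∃ L, Filter.Tendsto (fun n => (tensorChi (frobeniusComp p f n) G M : ℝ) /
      (p : ℝ) ^ (n * d)) Filter.atTop (nhds L) := by
  have hd' : ∀ P : PrimeSpectrum T, Order.coheight P < (d + 1 : ℕ) := by exact_mod_cast hd
  induction hM using IsNoetherianRing.induction_on_isQuotientEquivQuotientPrime T with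
  | subsingleton N => exact ⟨0, by simp [tensorChi_eq_zero]⟩
  | quotient N P eq =>
    have := P.2
    simp only [fun n => tensorChi_congr (frobeniusComp p f n) G eq]
    exact exists_tendsto_tensorChi_quotient F hbdd hd hfin hperf P.asIdeal
  | exact N₁ N₂ N₃ i j hi hj hij h1 h3 =>
    obtain ⟨L1, h1⟩ := h1
    obtain ⟨L3, h3⟩ := h3
    refine ⟨L1 + L3, ?_⟩
    simp only [fun n => F.tensorChi_add hbdd hd' i j hi hj hij n, Int.cast_add, add_div]
    exact h1.add h3

end LimitOverFFinite

/-! ### Reduction to finitely many maximal ideals -/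

section FiniteSupport

theorem finite_support_of_isFiniteLength {A N : Type*} [CommRing A] [AddCommGroup N] [Module A N]
    (hN : IsFiniteLength A N) : (Module.support A N).Finite := by
  induction hN with
  | of_subsingleton => rw [Module.support_eq_empty]; exact Set.finite_empty
  | @of_simple_quotient M _ _ N _ _ ih =>
    rw [Module.support_of_exact (LinearMap.exact_subtype_mkQ N) N.injective_subtype
      N.mkQ_surjective]
    refine ih.union ?_
    obtain ⟨I, hI, ⟨e⟩⟩ := isSimpleModule_iff_quot_maximal.1 ‹IsSimpleModule A (M ⧸ N)›
    refine (Set.finite_singleton (⟨I, hI.isPrime⟩ : PrimeSpectrum A)).subset fun P hP => ?_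
    rw [e.support_eq, mem_support_quotient_iff] at hP
    exact PrimeSpectrum.ext (hI.eq_of_le P.2.ne_top hP).symm

theorem finite_setOf_nullHomotopicElements_subset {A : Type u} [CommRing A]
    {G : ChainComplex (ModuleCat.{u} A) ℕ} (hbdd : IsBoundedComplex G)
    (hfree : IsFreeComplex G) (hfin : HasFiniteLengthHomology A G) :
    {P : PrimeSpectrum A | nullHomotopicElements G ⊆ P.asIdeal}.Finite := by
  obtain ⟨s, hs⟩ := id hbdd
  refine ((Finset.range (s + 1)).finite_toSet.biUnion fun i _ =>
    finite_support_of_isFiniteLength (hfin i)).subset fun P hP => ?_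
  obtain ⟨-, i, hi⟩ := isMaximal_of_nullHomotopicElements_subset hbdd hfree hfin P.asIdeal hP
  refine Set.mem_biUnion (x := i) ?_ hi
  rw [Finset.mem_coe, Finset.mem_range]
  by_contra hlt
  have := hs i (by omega)
  have : Subsingleton (G.homology i) := ModuleCat.subsingleton_of_isZero
    (HomologicalComplex.ExactAt.of_isZero (ModuleCat.isZero_of_subsingleton (G.X i))).isZero_homology
  rw [Module.support_eq_empty] at hi
  exact hi

end FiniteSupport

section QuotientBaseChange

variable {A T : Type u} [CommRing A] [CommRing T] (ψ : A →+* T) (m : Ideal A)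

/-- The base change of `A / m` is `T / mT`. -/
theorem nonempty_extendScalars_quotient_equiv : Nonempty
    ((ModuleCat.extendScalars.{u, u, u} ψ).obj (ModuleCat.of A (A ⧸ m)) ≃ₗ[T] (T ⧸ m.map ψ)) := by
  let _ := ψ.toAlgebra
  have e : T ⊗[A] (A ⧸ m) ≃ₗ[T] (T ⧸ m.map (algebraMap A T)) :=
    (Algebra.TensorProduct.quotIdealMapEquivTensorQuot T m).symm.toLinearEquiv
  exact ⟨e⟩

theorem length_extendScalars_quotient : Module.length T
    ((ModuleCat.extendScalars.{u, u, u} ψ).obj (ModuleCat.of A (A ⧸ m))) =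
      Module.length T (T ⧸ m.map ψ) :=
  (nonempty_extendScalars_quotient_equiv ψ m).some.length_eq

end QuotientBaseChange

section LocalFamily

variable {R T : Type u} [CommRing R] [CommRing T] {p : ℕ} [Fact p.Prime] [CharP R p] [CharP T p]
  [IsLocalRing T] (f : R →+* T) (m : Ideal R) [m.IsMaximal]

/-- Since P lies in mT, its contraction lies in m and equals it by maximality; so P also contains
mT. -/
theorem isMaximal_of_comap_isMaximal (hf : (m.map f).IsMaximal) (P : Ideal T) [hP : P.IsPrime]
    (h : (P.comap f).IsMaximal) : P.IsMaximal ∧ P.comap f = m := by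
  have h1 : P ≤ m.map f := by
    rw [IsLocalRing.eq_maximalIdeal hf]
    exact IsLocalRing.le_maximalIdeal hP.ne_top
  have h2 : (m.map f).comap f = m := (Ideal.IsMaximal.eq_of_le ‹m.IsMaximal›
    (Ideal.comap_ne_top f hf.ne_top) Ideal.le_comap_map).symm
  have h3 : P.comap f = m := by
    rw [← h2]
    exact h.eq_of_le (Ideal.comap_ne_top f hf.ne_top) (Ideal.comap_mono h1)
  refine ⟨?_, h3⟩
  have h4 : P = m.map f := le_antisymm h1 (Ideal.map_le_iff_le_comap.2 h3.ge)
  rwa [h4]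

omit [CharP R p] [m.IsMaximal] in
theorem length_restrictScalars_frobenius_quotient (hf : (m.map f).IsMaximal)
    (hperf : ∀ t, ∃ s, t - s ^ p ∈ m.map f) (n : Ideal T) (hn : n.IsMaximal) :
    Module.length T ((ModuleCat.restrictScalars.{u} (frobenius T p)).obj
      (ModuleCat.of T (T ⧸ n))) = 1 := by
  have hnm : n = m.map f := by
    rw [IsLocalRing.eq_maximalIdeal hf, IsLocalRing.eq_maximalIdeal hn]
  let _ := Ideal.Quotient.field n
  have h := length_restrictScalars_of_surjective ((Ideal.Quotient.mk n).comp (frobenius T p))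
    (fun y => by
      obtain ⟨t, rfl⟩ := Ideal.Quotient.mk_surjective y
      obtain ⟨s, hs⟩ := hperf t
      exact ⟨s, (Ideal.Quotient.eq.2 (hnm ▸ hs)).symm⟩) (ModuleCat.of (T ⧸ n) (T ⧸ n))
  rw [Module.length_eq_one (T ⧸ n) (T ⧸ n)] at h
  exact h

end LocalFamily

/-! ### Existence of the limit over R -/

section Decomposition

variable {R : Type u} [CommRing R] [IsNoetherianRing R] [FiniteRingKrullDim R] {p : ℕ}
  [Fact p.Prime] [CharP R p]
  {G : ChainComplex (ModuleCat.{u} R) ℕ} (hbdd : IsBoundedComplex G)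
  (hfree : IsFreeComplex G) (hfin : HasFiniteLengthHomology R G)
include hbdd hfree hfin

theorem homologyLength_frobeniusComp_id_ne_top (n i : ℕ) :
    homologyLength (frobeniusComp p (RingHom.id R) n) (ModuleCat.of R R) G i ≠ ⊤ := by
  have F := powerAnnihilatedFamily p (RingHom.id R) hbdd hfree hfin fun P _ h => fun _ _ => by
    rwa [Ideal.comap_id] at *
  exact F.homologyLength_ne_top (d := krullDimNat R + 1)
    (fun P => by exact_mod_cast coheight_lt_krullDimNat_add_one P) R n i

/-- By flatness it is enough to treat simple modules R/M with M in the support. Such an M is exactly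
one `m j`; its base change to that `T j` is the residue field, and to the others it is zero. -/
theorem sum_homologyLength_frobeniusComp {ι : Type*} [Fintype ι] (m : ι → Ideal R)
    (hm : ∀ j, (m j).IsMaximal) (hinj : Function.Injective m)
    (hsurj : ∀ M : Ideal R, M.IsPrime → nullHomotopicElements G ⊆ M → ∃ j, m j = M)
    {T : ι → Type u} [∀ j, CommRing (T j)] [∀ j, CharP (T j) p]
    [∀ j, IsLocalRing (T j)] (f : ∀ j, R →+* T j) (hf : ∀ j, (f j).Flat)
    (hmax : ∀ j, ((m j).map (f j)).IsMaximal) (n i : ℕ) :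
    ∑ j, homologyLength (frobeniusComp p (f j) n) (ModuleCat.of (T j) (T j)) G i =
      homologyLength (frobeniusComp p (RingHom.id R) n) (ModuleCat.of R R) G i := by
  let N := (baseChange (frobeniusComp p (RingHom.id R) n) G).homology i
  have hN : IsFiniteLength R N := Module.length_ne_top_iff.1
    (homologyLength_frobeniusComp_id_ne_top hbdd hfree hfin n i)
  have key := sum_length_extendScalars f hf hN fun M hM hMN => by
    -- Since x^(p^n) kills the homology of the n-th pull-back, the same finite set of maximal ideals
    -- serves for every n.
    have hsub : nullHomotopicElements G ⊆ M := fun x ⟨hx⟩ => by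
      refine hM.isPrime.mem_of_pow_mem (p ^ n) ?_
      have h1 := smul_homology_tensorComplex_eq_zero (frobeniusComp p (RingHom.id R) n)
        (ModuleCat.of R R) G x hx i
      rw [frobeniusComp_apply] at h1
      refine Module.annihilator_le_of_mem_support (hMN hM.isPrime) ?_
      rw [Module.mem_annihilator]
      intro y
      exact congrArg (fun g => g.hom y) h1
    obtain ⟨j, hj⟩ := hsurj M hM.isPrime hsub
    subst hj
    rw [Finset.sum_eq_single j]
    · rw [length_extendScalars_quotient]
      have : IsSimpleModule (T j) (T j ⧸ (m j).map (f j)) :=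
        isSimpleModule_iff_quot_maximal.2 ⟨_, hmax j, ⟨LinearEquiv.refl _ _⟩⟩
      exact Module.length_eq_one _ _
    · intro k _ hk
      have htop : (m j).map (f k) = ⊤ := by
        by_contra hne
        have h1 : (m j).map (f k) ≤ (m k).map (f k) := by
          rw [IsLocalRing.eq_maximalIdeal (hmax k)]
          exact IsLocalRing.le_maximalIdeal hne
        have h2 : (m j) ⊔ (m k) = ⊤ :=
          (hm j).coprime_of_ne (hm k) fun h => hk (hinj h.symm)
        have h3 := congrArg (Ideal.map (f k)) h2
        rw [Ideal.map_sup, sup_of_le_right h1, Ideal.map_top] at h3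
        exact (hmax k).ne_top h3
      rw [length_extendScalars_quotient, htop]
      have : Subsingleton (T k ⧸ (⊤ : Ideal (T k))) := Ideal.Quotient.subsingleton_iff.2 rfl
      exact Module.length_eq_zero
    · exact fun h => absurd (Finset.mem_univ _) h
  refine Eq.trans (Finset.sum_congr rfl fun j _ => ?_) key
  have h1 := length_homology_eq_of_iso (baseChangeComp (frobeniusComp p (RingHom.id R) n) (f j) G) i
  rw [length_homology_baseChange_of_flat (f j) (hf j)] at h1
  exact h1

/-- The Euler characteristic over R is the sum of those over the local extensions at the finitely
many relevant maximal ideals. All are normalised with dim R, which bounds the dimension of each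
extension, so the limits add. -/
theorem exists_isLimitMultiplicity : ∃ L, IsLimitMultiplicity p R G L := by
  let ι := {P : PrimeSpectrum R // nullHomotopicElements G ⊆ P.asIdeal}
  have : Finite ι := finite_setOf_nullHomotopicElements_subset hbdd hfree hfin
  have := Fintype.ofFinite ι
  let m : ι → Ideal R := fun j => j.1.asIdeal
  have hm : ∀ j, (m j).IsMaximal := fun j =>
    (isMaximal_of_nullHomotopicElements_subset hbdd hfree hfin _ j.2).1
  choose T hring hchar f hnoeth hloc hflat hmax hfrob hperf using
    fun j : ι => exists_flat_local_extension p R (m j)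
  have hsum := sum_homologyLength_frobeniusComp (p := p) hbdd hfree hfin m hm
    (fun j k h => Subtype.ext (PrimeSpectrum.ext h))
    (fun M hM h => ⟨⟨⟨M, hM⟩, h⟩, rfl⟩) f hflat hmax
  have hF := fun j => powerAnnihilatedFamily p (f j) hbdd hfree hfin fun P hP _ h _ =>
    (isMaximal_of_comap_isMaximal (f j) (m j) (hmax j) P h).1
  have hd : ∀ j (P : PrimeSpectrum (T j)), Order.coheight P < (krullDimNat R : ℕ∞) + 1 :=
    fun j P => coheight_lt_of_isMaximal_map (f j) (m j) (hmax j) P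
  choose L hL using fun j => exists_tendsto_tensorChi (hF j) hbdd (hd j) (hfrob j)
    (length_restrictScalars_frobenius_quotient (f j) (m j) (hmax j) (hperf j)) (T j)
  have hχ : ∀ n, tensorChi (frobeniusComp p (RingHom.id R) n) G R =
      ∑ j, tensorChi (frobeniusComp p (f j) n) G (T j) := fun n => by
    obtain ⟨s, hs⟩ := id hbdd
    have hz : ∀ {B : Type u} [CommRing B] (φ : R →+* B) i, s + 1 ≤ i →
        Module.length B ((tensorComplex φ (ModuleCat.of B B) G).homology i) = 0 := fun φ i hi => by
      have := hs i (by omega)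
      exact homologyLength_eq_zero_of_subsingleton φ G _ i
    have h1 := fun j => eulerChar_eq_sum _ (s + 1) (hz (frobeniusComp p (f j) n))
    have h2 := eulerChar_eq_sum _ (s + 1) (hz (frobeniusComp p (RingHom.id R) n))
    unfold tensorChi
    rw [h2, Finset.sum_congr rfl fun j _ => h1 j, Finset.sum_comm]
    refine Finset.sum_congr rfl fun i _ => ?_
    rw [← Finset.mul_sum, ← Nat.cast_sum]
    congr 2
    have h3 := hsum n i
    change (homologyLength (frobeniusComp p (RingHom.id R) n) (ModuleCat.of R R) G i).toNat = _
    rw [← h3]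
    refine ENat.toNat_sum fun j _ => ?_
    exact (hF j).homologyLength_ne_top (d := krullDimNat R + 1)
      (fun P => by exact_mod_cast hd j P) (T j) n i
  refine ⟨∑ j, L j, fun n i => ?_, ?_⟩
  · rw [← Module.length_ne_top_iff,
      length_homologyOver_eq_of_iso (frobeniusFunctorIterTensorIso p G n) i]
    exact homologyLength_frobeniusComp_id_ne_top hbdd hfree hfin n i
  · simp only [eulerChar_frobenius, hχ, Int.cast_sum, Finset.sum_div]
    exact tendsto_finsetSum _ fun j _ => hL j

end Decomposition

end

theorem lemma1 (p : ℕ) [Fact p.Prime]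
    (R S : Type u) [CommRing R] [IsDomain R] [IsNoetherianRing R] [FiniteRingKrullDim R]
    [CharP R p] [CommRing S] [CharP S p] [Algebra R S] [FaithfulSMul R S] [Module.Finite R S]
    (r : ℕ) (hr : Module.finrank R S = r)
    (G : ChainComplex (ModuleCat.{u} R) ℕ) (hbdd : IsBoundedComplex G) (hfree : IsFreeComplex G)
    (hfin : HasFiniteLengthHomology R G) :
    ∃ L : ℝ,
      IsLimitMultiplicity p R G L ∧
      IsLimitMultiplicity p R (baseChange (algebraMap R S) G) (r * L) ∧
      ((∀ n : Ideal S, n.IsMaximal → Function.Surjective (algebraMap R (S ⧸ n))) →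
        IsLimitMultiplicity p S (baseChange (algebraMap R S) G) (r * L)) := by
  subst hr
  obtain ⟨L, hL⟩ := exists_isLimitMultiplicity (p := p) hbdd hfree hfin
  have hLS := isLimitMultiplicity_baseChange p R S G hbdd hfree hfin hL
  exact ⟨L, hL, hLS, fun h => hLS.of_surjective p R S h _⟩
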